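/- Let $X_1,X_2,\dots$ be i.i.d. real random variables with $E X_1=0$ and $E X_1^2=1$ (so their distribution is nondegenerate), and put $M_n=\max_{1\le i\le n}X_i$ and $S_n=\sum_{i=1}^n X_i$. Suppose that there are constants $a_n>0$, $b_n\in\mathbb R$ $(n\ge1)$ such that for every $x\in\mathbb R$ $$\lim_{n\to\infty}P\big(a_n(M_n-b_n)\le x\big)=G(x),$$ where $G$ is one of the extreme value distribution functions - $\Lambda(x)=\exp(-e^{-x})$; - $\Phi_\alpha(x)=\exp(-x^{-\alpha})$ for $x>0$ and $\Phi_\alpha(x)=0$ for $x\le0$, with some $\alpha>2$; - $\Psi_\alpha(x)=\exp(-(-x)^{\alpha})$ for $x\le0$ and $\Psi_\alpha(x)=1$ for $x>0$, with some $\alpha>0$. Let $s\ge1$ and let $x_1\ge x_2\ge\dots\ge x_s$ be real numbers with $G(x_j)>0$ for all $j$. Put $u_n^{(j)}=a_n^{-1}x_j+b_n$ and $\tau_j=-\log G(x_j)\in[0,\infty)$, and let $\widetilde N_n$ be the point process on $(0,1]\times\mathbb R$ $$\widetilde N_n(B)=\sum_{j=1}^{s}\sum_{i=1}^{n}\mathbf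 1\big\{X_i>u_n^{(j)},\ (i/n,j)\in B\big\},\qquad B\subseteq(0,1]\times\mathbb R\ \text{Borel}.$$ Let $N^{(s)}$ be a homogeneous Poisson process on $(0,1]$ with intensity $\tau_s$, and for $j=s-1,\dots,1$ let $N^{(j)}$ be obtained from $N^{(j+1)}$ by independent thinning, each point of $N^{(j+1)}$ being deleted with probability $1-\tau_j/\tau_{j+1}$ (if $\tau_{j+1}=0$ there are no points to delete). Let $\widetilde N$ be the point process on $(0,1]\times\mathbb R$ that is the sum over $j=1,\dots,s$ of the processes $N^{(j)}$ placed on the lines $(0,1]\times\{j\}$, that is, $$\widetilde N(B)=\sum_{j=1}^s N^{(j)}\big(\{t\in(0,1]:(t,j)\in B\}\big).$$ Regard point processes as random elements of the space of finite measures on $(0,1]\times\mathbb R$ with the topology of weak convergence. Then, as $n\to\infty$, $$\widetilde N_n\xrightarrow{\ d\ }\widetilde N,$$ and $\widetilde N_n$ and $S_n/\sqrt n$ are asymptotically independent, that is, $$\Big(\widetilde N_n,\frac{S_n}{\sqrt n}\Big)\xrightarrow{\ d\ }(\widetilde N,Z),$$ where $Z$ is a standard normal random variable independent of $\widetilde N$.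 -/

import Mathlib

open MeasureTheory ProbabilityTheory Filter
open scoped Topology

noncomputable section

/-! ### Extreme value distributions -/

/-- The Gumbel distribution function `Λ`. -/
def gumbelCDF (z : ℝ) : ℝ := Real.exp (-Real.exp (-z))

/-- The Fréchet distribution function `Φ_α`. -/
def frechetCDF (α z : ℝ) : ℝ := if z ≤ 0 then 0 else Real.exp (-z ^ (-α))

/-- The Weibull distribution function `Ψ_α`. -/
def weibullCDF (α z : ℝ) : ℝ := if z ≤ 0 then Real.exp (-(-z) ^ α) else 1

/-- `G` is `Λ`, or `Φ_α` with `α > 2`, or `Ψ_α` with `α > 0`. -/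
def IsFiniteVarianceExtremeValueCDF (G : ℝ → ℝ) : Prop :=
  G = gumbelCDF ∨ (∃ α : ℝ, 2 < α ∧ G = frechetCDF α) ∨ (∃ α : ℝ, 0 < α ∧ G = weibullCDF α)

/-! ### Maxima, partial sums and levels

A sequence `X₁, X₂, …` is indexed from zero: `X i` stands for `X_{i+1}`. -/

/-- The maximum of the first `n` variables (with the irrelevant value `0` for `n = 0`). -/
def partialMax {Ω : Type*} (X : ℕ → Ω → ℝ) (n : ℕ) (ω : Ω) : ℝ := ⨆ i : Fin n, X i ω

/-- The sum of the first `n` variables. -/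
def partialSum {Ω : Type*} (X : ℕ → Ω → ℝ) (n : ℕ) (ω : Ω) : ℝ := ∑ i : Fin n, X i ω

/-- The level `u_n(z) = a_n⁻¹ z + b_n`. -/
def level (a b : ℕ → ℝ) (n : ℕ) (z : ℝ) : ℝ := (a n)⁻¹ * z + b n

/-! ### Point processes on `(0,1] × ℝ` -/

/-- The half-open time interval `(0,1]`. -/
abbrev TimeInterval : Type := Set.Ioc (0 : ℝ) 1

/-- The state space `(0,1] × ℝ` of the point processes. -/
abbrev StateSpace : Type := TimeInterval × ℝ

/-- Lebesgue measure on `(0,1]`, that is, the uniform distribution. -/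
def uniformTime : Measure TimeInterval := (volume : Measure ℝ).comap Subtype.val

instance isProbabilityMeasure_uniformTime : IsProbabilityMeasure uniformTime := by
  constructor
  rw [uniformTime, comap_subtype_coe_apply measurableSet_Ioc, Set.image_univ, Subtype.range_coe,
    Real.volume_Ioc]
  simp

/-- The unit mass at `p`, as a finite measure. -/
def pointMass (p : StateSpace) : FiniteMeasure StateSpace :=
  ⟨Measure.dirac p, inferInstance⟩

/-- The rescaled time `i / n` of the `i`-th variable (which is the one with zero-based index
`i - 1`). -/
def scaledTime {n : ℕ} (i : Fin n) : TimeInterval :=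
  ⟨((i : ℝ) + 1) / n, by
    have hi : ((i : ℕ) : ℝ) + 1 ≤ n := by exact_mod_cast i.isLt
    have hn : (0 : ℝ) < n := lt_of_lt_of_le (by positivity) hi
    exact ⟨by positivity, (div_le_one hn).2 hi⟩⟩

/-- The label `1, 2, …, r + 1` of the level with zero-based index `j`. -/
def levelLabel {r : ℕ} (j : Fin (r + 1)) : ℝ := (j : ℝ) + 1

open scoped Classical in
/-- The point process of exceedances of the levels `u_n(x j)`, as a random counting measure on
`(0,1] × ℝ`: one unit mass at `(i/n, j)` for every `i ≤ n` and every level `j` exceeded by the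
`i`-th variable. -/
def exceedanceProcess {Ω : Type*} (X : ℕ → Ω → ℝ) (a b : ℕ → ℝ) {r : ℕ} (x : Fin (r + 1) → ℝ)
    (n : ℕ) (ω : Ω) : FiniteMeasure StateSpace :=
  ∑ j : Fin (r + 1), ∑ i : Fin n,
    if level a b n (x j) < X i ω then pointMass (scaledTime i, levelLabel j) else 0

/-! ### The successively thinned Poisson processes -/

/-- The intensity `log G⁻¹(z) = -log G(z)`. -/
def exceedanceIntensity (G : ℝ → ℝ) (z : ℝ) : ℝ := -Real.log (G z)

/-- The probability with which a point of the process at level `m + 1` is kept at level `m`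
(one minus the deleting probability). If the denominator vanishes the process at level `m + 1` has
no points, so that the value is immaterial. -/
def retentionProb (G : ℝ → ℝ) {r : ℕ} (x : Fin (r + 1) → ℝ) (m : Fin r) : ℝ :=
  exceedanceIntensity G (x m.castSucc) / exceedanceIntensity G (x m.succ)

/-- The sample space of the limit process: the number `κ` of points of the Poisson process at the
last (lowest) level, the positions `U₀, U₁, …` of the points (those with index `< κ` are used), and
for every point index a family of uniform variables, one for each of the `r` thinnings. -/
abbrev ThinningSpace (r : ℕ) : Type := ℕ × (ℕ → TimeInterval) × (ℕ → Fin r → TimeInterval)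

/-- Under this law the number of points is Poisson, the positions are uniform on `(0,1]`, the
thinning variables are uniform on `(0,1]`, and everything is independent. -/
def thinningLaw (G : ℝ → ℝ) {r : ℕ} (x : Fin (r + 1) → ℝ) : Measure (ThinningSpace r) :=
  (poissonMeasure (exceedanceIntensity G (x (Fin.last r))).toNNReal).prod
    ((Measure.infinitePi fun _ : ℕ => uniformTime).prod
      (Measure.infinitePi fun _ : ℕ => Measure.pi fun _ : Fin r => uniformTime))

instance isProbabilityMeasure_thinningLaw (G : ℝ → ℝ) {r : ℕ} (x : Fin (r + 1) → ℝ) :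
    IsProbabilityMeasure (thinningLaw G x) := by
  unfold thinningLaw
  infer_instance

/-- The `i`-th point of the Poisson process at the last level is still present at level `j`: it has
survived all the thinnings from level `m + 1` to level `m` with `m ≥ j`, where survival means that
the corresponding uniform variable is at most the retention probability. -/
def SurvivesTo (G : ℝ → ℝ) {r : ℕ} (x : Fin (r + 1) → ℝ) (v : Fin r → TimeInterval)
    (j : Fin (r + 1)) : Prop :=
  ∀ m : Fin r, j ≤ m.castSucc → (v m : ℝ) ≤ retentionProb G x m

open scoped Classical in
/-- The process `N^(j)` at level `j`, placed on the line `(0,1] × {j}`. For the last level no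
thinning is applied, and this is the Poisson process with intensity `-log G(x_last)`. -/
def thinnedPoisson (G : ℝ → ℝ) {r : ℕ} (x : Fin (r + 1) → ℝ) (j : Fin (r + 1))
    (ζ : ThinningSpace r) : FiniteMeasure StateSpace :=
  ∑ i ∈ Finset.range ζ.1,
    if SurvivesTo G x (ζ.2.2 i) j then pointMass (ζ.2.1 i, levelLabel j) else 0

/-- The limit process: the sum of the processes at the different levels. -/
def limitProcess (G : ℝ → ℝ) {r : ℕ} (x : Fin (r + 1) → ℝ) (ζ : ThinningSpace r) :
    FiniteMeasure StateSpace :=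
  ∑ j : Fin (r + 1), thinnedPoisson G x j ζ

/-! ### Convergence in distribution and asymptotic independence -/

/-- Convergence in distribution of random elements of a topological space with its Borel
`σ`-algebra (for point processes the space is the one of finite measures with the weak topology). -/
def ConvergesInDistribution {E Ω Ω' : Type*} [TopologicalSpace E] [MeasurableSpace Ω]
    [MeasurableSpace Ω'] (P : Measure Ω) [IsProbabilityMeasure P] (ξ : ℕ → Ω → E)
    (Q : Measure Ω') [IsProbabilityMeasure Q] (ξlim : Ω' → E) : Prop :=
  letI : MeasurableSpace E := borel E
  haveI : BorelSpace E := ⟨rfl⟩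
  TendstoInDistribution ξ atTop ξlim (fun _ => P) Q

/-- Two sequences of random elements, of which the first converges in distribution to `ξlim` and
the second to `ηlim`, are asymptotically independent: the pairs converge in distribution to a pair
of independent copies of the limits, realized on a product space. -/
def AsymptoticallyIndependent {E E' Ω Ω' Ω'' : Type*} [TopologicalSpace E] [TopologicalSpace E']
    [MeasurableSpace Ω] [MeasurableSpace Ω'] [MeasurableSpace Ω'']
    (P : Measure Ω) [IsProbabilityMeasure P] (ξ : ℕ → Ω → E) (η : ℕ → Ω → E')
    (Q : Measure Ω') [IsProbabilityMeasure Q] (ξlim : Ω' → E)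
    (R : Measure Ω'') [IsProbabilityMeasure R] (ηlim : Ω'' → E') : Prop :=
  ConvergesInDistribution P (fun n ω => (ξ n ω, η n ω))
    (Q.prod R) (fun p => (ξlim p.1, ηlim p.2))

end

/-! Attach to each variable `X i` its mark, the set of levels it exceeds. The exceedance process
places at time `i/n` the cluster determined by the mark of the `i`-th variable
(`exceedanceProcess_eq`). Hence for bounded continuous `g` and real `u` the joint characteristic
functional of process and normalized sum is a product over `i`, by independence. The mark is
nonempty with probability `O(1/n)`.

Up to an error, each factor minus one splits into a part from the sum, `charFun μ (u/√n) - 1`, and a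
part from the mark. The error is the mean of a product of two factors: the first vanishes unless the
mark is nonempty, the second is at most `|u y|/√n`. Since the second moment is finite and nonempty
marks have probability `O(1/n)`, the error is `o(1/n)` (`tendsto_sqrt_mul_setIntegral_abs`). This is
the source of asymptotic independence: the few variables that exceed a level do not contribute to
the sum at scale `√n`. Adding over `i` gives `-u²/2` plus a Riemann sum for the exponent of a
Poisson process of clusters (`tendsto_prod_integral_exp`), which is the functional of the limit pair
(`integral_pairCharacter_limit`).

The cluster intensities agree because marks are upper sets of level indices, both for exceedances
and for successive thinning. Probabilities of nonempty upper sets are linear combinations of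
single-level probabilities (`exists_coeff_indicator_eq`). For single levels, `(1 - p)^n → G(x_j)`
gives `n p → -log G(x_j)`, and the retention probabilities telescope to the same value
(`intensity_mul_survivesTo`).

Passing from characteristic functionals to convergence in distribution takes Stone–Weierstrass on
compact sets together with tightness. Tightness comes from explicit compact sets: sums of boundedly
many clusters at times bounded away from zero, times an interval. -/

/-! ### A criterion for convergence in distribution -/

section Criterion

variable {X Ω Ω' : Type*} [TopologicalSpace X] [MeasurableSpace Ω] [MeasurableSpace Ω']

/-- A bounded continuous function is approximated on a compact set by elements of a separating
subalgebra that satisfy a bound on the whole space. -/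
lemma exists_mem_subalgebra_near_of_isCompact {A : Subalgebra ℝ C(X, ℝ)}
    (hsep : A.SeparatesPoints) (hbdd : ∀ h ∈ A, ∃ C, ∀ x, |h x| ≤ C)
    (f : C(X, ℝ)) {C : ℝ} (hf : ∀ x, |f x| ≤ C) {K : Set X} (hK : IsCompact K)
    {ε : ℝ} (hε : 0 < ε) :
    ∃ h ∈ A, (∀ x ∈ K, |h x - f x| ≤ ε) ∧ ∀ x, |h x| ≤ C + ε := by
  obtain ⟨g, hgA, hg⟩ :=
    ContinuousMap.exists_mem_subalgebra_near_continuous_of_isCompact_of_separatesPoints hsep f hK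
      (half_pos hε)
  obtain ⟨R, hR⟩ := hbdd g hgA
  -- Off `K` the function `g` is bounded only by the uncontrolled `R`. A polynomial close on `[-R,
  -- R]` to the truncation at `±C` restores the bound and stays in the algebra; the truncation is
  -- 1-Lipschitz and fixes the values of `f`.
  obtain ⟨p, hp⟩ := exists_polynomial_near_of_continuousOn (-R) R (fun y => max (-C) (min y C))
    (by fun_prop) (ε / 2) (half_pos hε)
  have hclip : ∀ y, |y| ≤ C → max (-C) (min y C) = y := fun y hy => by
    rw [min_eq_left (abs_le.1 hy).2, max_eq_right (abs_le.1 hy).1]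
  have heval : ∀ x, (Polynomial.aeval g p) x = p.eval (g x) := fun x => by
    rw [Polynomial.aeval_continuousMap_apply]
  have hmem : ∀ x, g x ∈ Set.Icc (-R) R := fun x => abs_le.1 (hR x)
  refine ⟨Polynomial.aeval g p, ?_, fun x hx => ?_, fun x => ?_⟩
  · exact Algebra.adjoin_le (Set.singleton_subset_iff.2 hgA) (p.aeval_mem_adjoin_singleton ℝ g)
  · have h1 := abs_lt.1 (hp _ (hmem x))
    have h2 := abs_lt.1 (hg x hx)
    have h3 : |max (-C) (min (g x) C) - max (-C) (min (f x) C)| ≤ |g x - f x| := by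
      refine (abs_max_sub_max_le_max _ _ _ _).trans ?_
      rw [sub_self, abs_zero]
      refine max_le (abs_nonneg _) ((abs_min_sub_min_le_max _ _ _ _).trans ?_)
      simp
    rw [hclip _ (hf x)] at h3
    have h4 := abs_le.1 (h3.trans (hg x hx).le)
    rw [heval, abs_le]
    constructor <;> linarith
  · have h1 := abs_lt.1 (hp _ (hmem x))
    have hC : 0 ≤ C := (abs_nonneg _).trans (hf x)
    have h2 : |max (-C) (min (g x) C)| ≤ C :=
      abs_le.2 ⟨le_max_left _ _, max_le (by linarith) (min_le_right _ _)⟩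
    have h3 := abs_le.1 h2
    rw [heval, abs_le]
    constructor <;> linarith

lemma abs_integral_sub_le_of_compl {μ : Measure Ω} [IsProbabilityMeasure μ] {f g : Ω → ℝ}
    (hf : Integrable f μ) (hg : Integrable g μ) {s : Set Ω} (hs : MeasurableSet s) {ε D : ℝ}
    (hε : 0 ≤ ε) (h1 : ∀ x ∈ s, |f x - g x| ≤ ε) (h2 : ∀ x, |f x - g x| ≤ D) :
    |∫ x, f x ∂μ - ∫ x, g x ∂μ| ≤ ε + D * μ.real sᶜ := by
  rw [← integral_sub hf hg]
  have hint : Integrable (fun x => ε + sᶜ.indicator (fun _ => D) x) μ :=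
    (integrable_const _).add ((integrable_const _).indicator hs.compl)
  calc |∫ x, (f x - g x) ∂μ| ≤ ∫ x, |f x - g x| ∂μ := abs_integral_le_integral_abs
    _ ≤ ∫ x, (ε + sᶜ.indicator (fun _ => D) x) ∂μ := by
        refine integral_mono (hf.sub hg).abs hint fun x => ?_
        by_cases hx : x ∈ s
        · simpa [hx] using h1 x hx
        · simpa [hx] using (h2 x).trans (by linarith)
    _ = ε + D * μ.real sᶜ := by
        rw [integral_add (integrable_const _) ((integrable_const _).indicator hs.compl),
          integral_indicator_const _ hs.compl]
        simp [mul_comm]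

/-- Random elements of a Hausdorff space that are asymptotically tight converge in distribution as
soon as the expectations of all elements of a separating algebra of bounded continuous functions
converge. -/
theorem convergesInDistribution_of_subalgebra [T2Space X] (P : Measure Ω) [IsProbabilityMeasure P]
    (ξ : ℕ → Ω → X) (Q : Measure Ω') [IsProbabilityMeasure Q] (ζ : Ω' → X)
    {A : Subalgebra ℝ C(X, ℝ)} (hsep : A.SeparatesPoints)
    (hbdd : ∀ h ∈ A, ∃ C, ∀ x, |h x| ≤ C)
    (hξ : ∀ n, Measurable[_, borel X] (ξ n)) (hζ : Measurable[_, borel X] ζ)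
    (hconv : ∀ h ∈ A, Tendsto (fun n => ∫ ω, h (ξ n ω) ∂P) atTop (𝓝 (∫ ω, h (ζ ω) ∂Q)))
    (htight : ∀ ε > 0, ∃ K : Set X, IsCompact K ∧ Q.real {ω | ζ ω ∉ K} ≤ ε ∧
      ∀ᶠ n in atTop, P.real {ω | ξ n ω ∉ K} ≤ ε) :
    ConvergesInDistribution P ξ Q ζ := by
  let _ : MeasurableSpace X := borel X
  have _ : BorelSpace X := ⟨rfl⟩
  change TendstoInDistribution ξ atTop ζ (fun _ => P) Q
  refine ⟨fun n => (hξ n).aemeasurable, hζ.aemeasurable, ?_⟩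
  refine ProbabilityMeasure.tendsto_iff_forall_integral_tendsto.2 fun f => ?_
  have hmapn : ∀ n, ∫ x, f x ∂(P.map (ξ n)) = ∫ ω, f (ξ n ω) ∂P := fun n =>
    integral_map (hξ n).aemeasurable f.continuous.measurable.aestronglyMeasurable
  have hmap : ∫ x, f x ∂(Q.map ζ) = ∫ ω, f (ζ ω) ∂Q :=
    integral_map hζ.aemeasurable f.continuous.measurable.aestronglyMeasurable
  simp only [ProbabilityMeasure.coe_mk, hmapn, hmap]
  have hC : ∀ x, |f x| ≤ ‖f‖ := fun x => f.norm_coe_le_norm x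
  have hint : ∀ h : C(X, ℝ), (∃ C, ∀ x, |h x| ≤ C) → ∀ {Ω₀ : Type _} [MeasurableSpace Ω₀]
      (μ : Measure Ω₀) [IsProbabilityMeasure μ] (η : Ω₀ → X), Measurable η →
      Integrable (fun ω => h (η ω)) μ := by
    rintro h ⟨C, hC⟩ Ω₀ _ μ _ η hη
    exact Integrable.of_bound (h.continuous.measurable.comp hη).aestronglyMeasurable C
      (Eventually.of_forall fun ω => hC _)
  have hint' : ∀ h : C(X, ℝ), (∃ C, ∀ x, |h x| ≤ C) → Integrable (fun ω => h (ζ ω)) Q := by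
    rintro h ⟨C, hC⟩
    exact Integrable.of_bound (h.continuous.measurable.comp hζ).aestronglyMeasurable C
      (Eventually.of_forall fun ω => hC _)
  rw [Metric.tendsto_atTop]
  intro ε hε
  -- `D` bounds `|h - f|` everywhere because `|h| ≤ ‖f‖ + δ` with `δ ≤ 1`. A mass of `ε / (8 * D)`
  -- outside `K` then costs `ε / 8`, and three errors of `ε / 4` remain below `ε`.
  set D : ℝ := 2 * ‖f‖ + 1 with hD
  have hDpos : 0 < D := by positivity
  set δ : ℝ := min 1 (ε / 8) with hδ
  have hδpos : 0 < δ := lt_min one_pos (by positivity)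
  obtain ⟨K, hK, hKQ, hKP⟩ := htight (ε / (8 * D)) (by positivity)
  obtain ⟨h, hA, hnear, hle⟩ :=
    exists_mem_subalgebra_near_of_isCompact hsep hbdd f.toContinuousMap hC hK hδpos
  have hKm : MeasurableSet K := hK.isClosed.measurableSet
  have hglob : ∀ x, |h x - f x| ≤ D := fun x => by
    have h1 := hle x
    have h2 := hC x
    have h3 : δ ≤ 1 := min_le_left _ _
    calc |h x - f x| ≤ |h x| + |f x| := abs_sub _ _
      _ ≤ D := by linarith
  have hcQ : |∫ ω, h (ζ ω) ∂Q - ∫ ω, f (ζ ω) ∂Q| ≤ ε / 4 := by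
    refine (abs_integral_sub_le_of_compl (hint' h (hbdd h hA)) (hint' f.toContinuousMap ⟨_, hC⟩)
      (hζ hKm) hδpos.le (fun ω hω => hnear _ hω) (fun ω => hglob _)).trans ?_
    have : D * Q.real (ζ ⁻¹' K)ᶜ ≤ D * (ε / (8 * D)) := by gcongr; exact hKQ
    have h2 : D * (ε / (8 * D)) = ε / 8 := by field_simp
    have h3 : δ ≤ ε / 8 := min_le_right _ _
    linarith
  obtain ⟨N₁, hN₁⟩ := eventually_atTop.1 hKP
  obtain ⟨N₂, hN₂⟩ := Metric.tendsto_atTop.1 (hconv h hA) (ε / 4) (by positivity)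
  refine ⟨max N₁ N₂, fun n hn => ?_⟩
  have hcP : |∫ ω, h (ξ n ω) ∂P - ∫ ω, f (ξ n ω) ∂P| ≤ ε / 4 := by
    refine (abs_integral_sub_le_of_compl (hint h (hbdd h hA) P (ξ n) (hξ n))
      (hint f.toContinuousMap ⟨_, hC⟩ P (ξ n) (hξ n))
      (hξ n hKm) hδpos.le (fun ω hω => hnear _ hω) (fun ω => hglob _)).trans ?_
    have : D * P.real (ξ n ⁻¹' K)ᶜ ≤ D * (ε / (8 * D)) := by
      gcongr; exact hN₁ n (le_of_max_le_left hn)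
    have h2 : D * (ε / (8 * D)) = ε / 8 := by field_simp
    have h3 : δ ≤ ε / 8 := min_le_right _ _
    linarith
  have hm := hN₂ n (le_of_max_le_right hn)
  rw [Real.dist_eq, abs_lt] at hm ⊢
  rw [abs_le] at hcP hcQ
  constructor <;> linarith

/-- Random elements of a Hausdorff space that are asymptotically tight converge in distribution as
soon as the expectations of all elements of a separating, conjugation-invariant monoid of bounded
continuous complex functions converge. -/
theorem convergesInDistribution_of_submonoid [T2Space X] (P : Measure Ω) [IsProbabilityMeasure P]
    (ξ : ℕ → Ω → X) (Q : Measure Ω') [IsProbabilityMeasure Q] (ζ : Ω' → X)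
    {S : Submonoid C(X, ℂ)} (hstar : ∀ χ ∈ S, star χ ∈ S)
    (hsep : ∀ x y, x ≠ y → ∃ χ ∈ S, χ x ≠ χ y)
    (hbdd : ∀ χ ∈ S, ∃ C, ∀ x, ‖χ x‖ ≤ C)
    (hξ : ∀ n, Measurable[_, borel X] (ξ n)) (hζ : Measurable[_, borel X] ζ)
    (hconv : ∀ χ ∈ S, Tendsto (fun n => ∫ ω, χ (ξ n ω) ∂P) atTop (𝓝 (∫ ω, χ (ζ ω) ∂Q)))
    (htight : ∀ ε > 0, ∃ K : Set X, IsCompact K ∧ Q.real {ω | ζ ω ∉ K} ≤ ε ∧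
      ∀ᶠ n in atTop, P.real {ω | ξ n ω ∉ K} ≤ ε) :
    ConvergesInDistribution P ξ Q ζ := by
  -- Products of characters are characters, so the generated algebra is the linear span, to which
  -- convergence of expectations extends by linearity.
  have hspan : Subalgebra.toSubmodule (Algebra.adjoin ℂ (S : Set C(X, ℂ))) =
      Submodule.span ℂ (S : Set C(X, ℂ)) := by
    rw [Algebra.adjoin_eq_span, Submonoid.closure_eq]
  have hmem : ∀ f, f ∈ Algebra.adjoin ℂ (S : Set C(X, ℂ)) ↔
      f ∈ Submodule.span ℂ (S : Set C(X, ℂ)) := fun f => by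
    rw [← hspan, Subalgebra.mem_toSubmodule]
  -- The real functions in the complex span. Invariance under `star` puts real and imaginary parts
  -- of characters into `A`, and one of the two separates any points that the character separates.
  let A : Subalgebra ℝ C(X, ℝ) := ((Algebra.adjoin ℂ (S : Set C(X, ℂ))).restrictScalars ℝ).comap
    (Complex.ofRealAm.compLeftContinuous ℝ Complex.continuous_ofReal)
  have hA : ∀ h : C(X, ℝ), h ∈ A ↔
      (⟨fun x => (h x : ℂ), by fun_prop⟩ : C(X, ℂ)) ∈ Submodule.span ℂ (S : Set C(X, ℂ)) :=
    fun h => hmem _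
  have hall : ∀ f ∈ Submodule.span ℂ (S : Set C(X, ℂ)), (∃ C, ∀ x, ‖f x‖ ≤ C) ∧
      Tendsto (fun n => ∫ ω, f (ξ n ω) ∂P) atTop (𝓝 (∫ ω, f (ζ ω) ∂Q)) := by
    let _ : MeasurableSpace X := borel X
    have _ : BorelSpace X := ⟨rfl⟩
    intro f hf
    induction hf using Submodule.span_induction with
    | mem χ hχ => exact ⟨hbdd χ hχ, hconv χ hχ⟩
    | zero => exact ⟨⟨0, by simp⟩, by simp⟩
    | add f g _ _ hf hg =>
      obtain ⟨⟨C, hC⟩, hf⟩ := hf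
      obtain ⟨⟨D, hD⟩, hg⟩ := hg
      refine ⟨⟨C + D, fun x => (norm_add_le _ _).trans (add_le_add (hC x) (hD x))⟩, ?_⟩
      have hP : ∀ (k : C(X, ℂ)) (B : ℝ), (∀ x, ‖k x‖ ≤ B) → ∀ n,
          Integrable (fun ω => k (ξ n ω)) P := fun k B hB n =>
        Integrable.of_bound (k.continuous.measurable.comp (hξ n)).aestronglyMeasurable B
          (Eventually.of_forall fun ω => hB _)
      have hQ : ∀ (k : C(X, ℂ)) (B : ℝ), (∀ x, ‖k x‖ ≤ B) →
          Integrable (fun ω => k (ζ ω)) Q := fun k B hB =>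
        Integrable.of_bound (k.continuous.measurable.comp hζ).aestronglyMeasurable B
          (Eventually.of_forall fun ω => hB _)
      simp only [ContinuousMap.add_apply]
      rw [integral_add (hQ f C hC) (hQ g D hD)]
      refine (hf.add hg).congr fun n => ?_
      rw [integral_add (hP f C hC n) (hP g D hD n)]
    | smul c f _ hf =>
      obtain ⟨⟨C, hC⟩, hf⟩ := hf
      refine ⟨⟨‖c‖ * C, fun x => ?_⟩, ?_⟩
      · rw [ContinuousMap.smul_apply, norm_smul]
        exact mul_le_mul_of_nonneg_left (hC x) (norm_nonneg _)
      · simp only [ContinuousMap.smul_apply, integral_smul]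
        exact hf.const_smul c
  refine convergesInDistribution_of_subalgebra P ξ Q ζ (A := A) ?_ (fun h hh => ?_) hξ hζ
    (fun h hh => ?_) htight
  · intro x y hxy
    obtain ⟨χ, hχ, hne⟩ := hsep x y hxy
    have hst := hstar χ hχ
    by_cases hre : (χ x).re = (χ y).re
    · have him : (χ x).im ≠ (χ y).im := fun h => hne (Complex.ext hre h)
      refine ⟨_, ⟨⟨fun z => (χ z).im, by fun_prop⟩, ?_, rfl⟩, him⟩
      rw [SetLike.mem_coe, hA]
      have : (⟨fun z => (((χ z).im : ℝ) : ℂ), by fun_prop⟩ : C(X, ℂ)) =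
          (1 / (2 * Complex.I)) • χ + (-(1 / (2 * Complex.I))) • star χ := by
        ext z
        simp only [ContinuousMap.coe_mk, ContinuousMap.add_apply, ContinuousMap.smul_apply,
          ContinuousMap.star_apply, smul_eq_mul, Complex.star_def, Complex.im_eq_sub_conj]
        ring
      exact this ▸ Submodule.add_mem _ (Submodule.smul_mem _ _ (Submodule.subset_span hχ))
        (Submodule.smul_mem _ _ (Submodule.subset_span hst))
    · refine ⟨_, ⟨⟨fun z => (χ z).re, by fun_prop⟩, ?_, rfl⟩, hre⟩
      rw [SetLike.mem_coe, hA]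
      have : (⟨fun z => (((χ z).re : ℝ) : ℂ), by fun_prop⟩ : C(X, ℂ)) =
          (1 / 2 : ℂ) • χ + (1 / 2 : ℂ) • star χ := by
        ext z
        simp only [ContinuousMap.coe_mk, ContinuousMap.add_apply, ContinuousMap.smul_apply,
          ContinuousMap.star_apply, smul_eq_mul, Complex.star_def, Complex.re_eq_add_conj]
        ring
      exact this ▸ Submodule.add_mem _ (Submodule.smul_mem _ _ (Submodule.subset_span hχ))
        (Submodule.smul_mem _ _ (Submodule.subset_span hst))
  · obtain ⟨C, hC⟩ := (hall _ ((hA h).1 hh)).1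
    exact ⟨C, fun x => by simpa using hC x⟩
  · have h1 := (hall _ ((hA h).1 hh)).2
    simp only [ContinuousMap.coe_mk] at h1
    have h2 := (Complex.continuous_re.tendsto _).comp h1
    have h3 : ∀ {Ω₀ : Type _} [MeasurableSpace Ω₀] (μ : Measure Ω₀) (k : Ω₀ → ℝ),
        (∫ ω, (k ω : ℂ) ∂μ).re = ∫ ω, k ω ∂μ := fun μ k => by
      rw [integral_complex_ofReal, Complex.ofReal_re]
    have h4 : (∫ ω, (h (ζ ω) : ℂ) ∂Q).re = ∫ ω, h (ζ ω) ∂Q := by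
      rw [integral_complex_ofReal, Complex.ofReal_re]
    rw [h4] at h2
    exact h2.congr fun n => h3 P _

end Criterion
open scoped Topology Pointwise

/-! ### Clusters of points at a common time -/

section Cluster

variable {r : ℕ}

/-- The sum of the unit masses at the points `(t, j)`, with `j` the labels of the levels in `A`. -/
noncomputable def clusterMeasure (A : Finset (Fin (r + 1))) (t : TimeInterval) :
    FiniteMeasure StateSpace :=
  ∑ j ∈ A, pointMass (t, levelLabel j)

/-- The sum of the values of `g` at the points of a cluster. -/
noncomputable def clusterSum (g : BoundedContinuousFunction StateSpace ℝ)
    (A : Finset (Fin (r + 1))) (t : TimeInterval) : ℝ :=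
  ∑ j ∈ A, g (t, levelLabel j)

lemma continuous_pointMass : Continuous pointMass := by
  have h := continuous_diracProba (X := StateSpace)
  exact ProbabilityMeasure.toFiniteMeasure_continuous.comp h

lemma continuous_clusterMeasure (A : Finset (Fin (r + 1))) : Continuous (clusterMeasure A) := by
  unfold clusterMeasure
  exact continuous_finsetSum _ fun j _ => continuous_pointMass.comp (by fun_prop)

lemma continuous_clusterSum (g : BoundedContinuousFunction StateSpace ℝ)
    (A : Finset (Fin (r + 1))) : Continuous (clusterSum g A) := by
  unfold clusterSum
  fun_prop

lemma clusterMeasure_empty (t : TimeInterval) :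
    clusterMeasure (∅ : Finset (Fin (r + 1))) t = 0 := rfl

lemma clusterSum_empty (g : BoundedContinuousFunction StateSpace ℝ) (t : TimeInterval) :
    clusterSum g (∅ : Finset (Fin (r + 1))) t = 0 := rfl

lemma integral_finiteMeasure_sum {ι : Type*} (g : BoundedContinuousFunction StateSpace ℝ)
    (s : Finset ι) (m : ι → FiniteMeasure StateSpace) :
    ∫ p, g p ∂((∑ i ∈ s, m i : FiniteMeasure StateSpace) : Measure StateSpace) =
      ∑ i ∈ s, ∫ p, g p ∂(m i : Measure StateSpace) := by
  rw [FiniteMeasure.toMeasure_sum, integral_finsetSum_measure]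
  exact fun i _ => g.integrable _

lemma integral_clusterMeasure (g : BoundedContinuousFunction StateSpace ℝ)
    (A : Finset (Fin (r + 1))) (t : TimeInterval) :
    ∫ p, g p ∂(clusterMeasure A t : Measure StateSpace) = clusterSum g A t := by
  rw [clusterMeasure, integral_finiteMeasure_sum]
  refine Finset.sum_congr rfl fun j _ => ?_
  change ∫ p, g p ∂(Measure.dirac (t, levelLabel j)) = _
  exact integral_dirac _ _

/-- The clusters at times not before `δ`, including the empty cluster. -/
def lateClusters (r : ℕ) (δ : ℝ) : Set (FiniteMeasure StateSpace) :=
  ⋃ A : Finset (Fin (r + 1)), clusterMeasure A '' {t | δ ≤ (t : ℝ)}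

/-- The interval `(0,1]` is open at zero, where mass could escape; compact sets of point measures
therefore have to exclude early points. -/
lemma isCompact_le_timeInterval {δ : ℝ} (hδ : 0 < δ) :
    IsCompact {t : TimeInterval | δ ≤ (t : ℝ)} := by
  rw [Subtype.isCompact_iff]
  convert isCompact_Icc (a := δ) (b := (1 : ℝ)) using 1
  ext t
  constructor
  · rintro ⟨s, hs, rfl⟩
    exact ⟨hs, s.2.2⟩
  · intro ht
    exact ⟨⟨t, hδ.trans_le ht.1, ht.2⟩, ht.1, rfl⟩

lemma isCompact_lateClusters {δ : ℝ} (hδ : 0 < δ) : IsCompact (lateClusters r δ) :=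
  isCompact_iUnion fun A => (isCompact_le_timeInterval hδ).image (continuous_clusterMeasure A)

lemma clusterMeasure_mem_lateClusters {δ : ℝ} (hδ : δ ≤ 1) {A : Finset (Fin (r + 1))}
    {t : TimeInterval} (h : A ≠ ∅ → δ ≤ (t : ℝ)) : clusterMeasure A t ∈ lateClusters r δ := by
  by_cases hA : A = ∅
  -- The time of an empty cluster is immaterial and may precede `δ`; time `1` serves as an
  -- admissible representative.
  · have h1 : (1 : ℝ) ∈ Set.Ioc (0 : ℝ) 1 := ⟨one_pos, le_rfl⟩
    refine Set.mem_iUnion.2 ⟨∅, ⟨1, h1⟩, hδ, ?_⟩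
    rw [hA, clusterMeasure_empty, clusterMeasure_empty]
  · exact Set.mem_iUnion.2 ⟨A, t, h hA, rfl⟩

/-- Sums of at most `N` clusters at times not before `δ`. -/
def lateClusterSums (r : ℕ) (δ : ℝ) : ℕ → Set (FiniteMeasure StateSpace)
  | 0 => {0}
  | N + 1 => lateClusters r δ + lateClusterSums r δ N

/-- Addition of finite measures is continuous, so Minkowski sums of compact sets are compact. -/
lemma isCompact_lateClusterSums {δ : ℝ} (hδ : 0 < δ) (N : ℕ) :
    IsCompact (lateClusterSums r δ N) := by
  induction N with
  | zero => exact isCompact_singleton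
  | succ N ih => exact (isCompact_lateClusters hδ).add ih

lemma lateClusterSums_mono {δ : ℝ} (hδ : δ ≤ 1) : Monotone (lateClusterSums r δ) := by
  refine monotone_nat_of_le_succ fun N m hm => ?_
  refine Set.mem_add.2 ⟨0, ?_, m, hm, zero_add m⟩
  have h1 : (1 : ℝ) ∈ Set.Ioc (0 : ℝ) 1 := ⟨one_pos, le_rfl⟩
  rw [← clusterMeasure_empty (r := r) ⟨1, h1⟩]
  exact clusterMeasure_mem_lateClusters hδ fun h => absurd rfl h

lemma sum_mem_lateClusterSums {δ : ℝ} {ι : Type*} [DecidableEq ι] (s : Finset ι)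
    (m : ι → FiniteMeasure StateSpace) (h : ∀ i ∈ s, m i ∈ lateClusters r δ) :
    ∑ i ∈ s, m i ∈ lateClusterSums r δ s.card := by
  induction s using Finset.induction_on with
  | empty => simp [lateClusterSums]
  | insert i s hi ih =>
    rw [Finset.sum_insert hi, Finset.card_insert_of_notMem hi]
    exact Set.add_mem_add (h i (Finset.mem_insert_self i s))
      (ih fun k hk => h k (Finset.mem_insert_of_mem hk))

/-- A sum of clusters with at most `N` nonempty ones, all of them not before `δ`, lies in the
compact set `lateClusterSums r δ N`. -/
lemma sum_clusterMeasure_mem_lateClusterSums {δ : ℝ} (hδ : δ ≤ 1) {ι : Type*} (s : Finset ι)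
    (A : ι → Finset (Fin (r + 1))) (t : ι → TimeInterval) {N : ℕ}
    (hcard : (s.filter fun i => A i ≠ ∅).card ≤ N)
    (hlate : ∀ i ∈ s, A i ≠ ∅ → δ ≤ (t i : ℝ)) :
    ∑ i ∈ s, clusterMeasure (A i) (t i) ∈ lateClusterSums r δ N := by
  classical
  have h : ∑ i ∈ s, clusterMeasure (A i) (t i) =
      ∑ i ∈ s.filter fun i => A i ≠ ∅, clusterMeasure (A i) (t i) := by
    symm
    refine Finset.sum_filter_of_ne (p := fun i => A i ≠ ∅) fun i _ hne hA => hne ?_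
    rw [hA, clusterMeasure_empty]
  rw [h]
  refine lateClusterSums_mono hδ hcard (sum_mem_lateClusterSums _ _ fun i hi => ?_)
  exact clusterMeasure_mem_lateClusters hδ (hlate i (Finset.mem_filter.1 hi).1)

end Cluster

/-! ### Characters of pairs of a finite measure and a real number -/

section Character

/-- The function `(m, z) ↦ exp (i (∫ g dm + u z))`. -/
noncomputable def pairCharacter (g : BoundedContinuousFunction StateSpace ℝ) (u : ℝ) :
    C(FiniteMeasure StateSpace × ℝ, ℂ) where
  toFun q := Complex.exp ((((∫ p, g p ∂(q.1 : Measure StateSpace)) + u * q.2 : ℝ) : ℂ) *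
    Complex.I)
  continuous_toFun := by
    have h := FiniteMeasure.continuous_integral_boundedContinuousFunction g
    have h' : Continuous fun q : FiniteMeasure StateSpace × ℝ =>
      (∫ p, g p ∂(q.1 : Measure StateSpace)) + u * q.2 := (h.comp continuous_fst).add (by fun_prop)
    exact Complex.continuous_exp.comp
      ((Complex.continuous_ofReal.comp h').mul continuous_const)

lemma pairCharacter_apply (g : BoundedContinuousFunction StateSpace ℝ) (u : ℝ)
    (m : FiniteMeasure StateSpace) (z : ℝ) :
    pairCharacter g u (m, z) = Complex.exp ((((∫ p, g p ∂(m : Measure StateSpace)) + u * z : ℝ)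
      : ℂ) * Complex.I) := rfl

lemma norm_pairCharacter (g : BoundedContinuousFunction StateSpace ℝ) (u : ℝ)
    (q : FiniteMeasure StateSpace × ℝ) : ‖pairCharacter g u q‖ = 1 :=
  Complex.norm_exp_ofReal_mul_I _

/-- The monoid of all the characters `pairCharacter g u`. -/
noncomputable def pairCharacters : Submonoid C(FiniteMeasure StateSpace × ℝ, ℂ) where
  carrier := {χ | ∃ g u, χ = pairCharacter g u}
  one_mem' := ⟨0, 0, by ext ⟨m, z⟩; simp [pairCharacter_apply]⟩
  mul_mem' := by
    rintro _ _ ⟨g, u, rfl⟩ ⟨h, v, rfl⟩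
    refine ⟨g + h, u + v, ?_⟩
    ext ⟨m, z⟩
    have hint : ∫ p, (g + h) p ∂(m : Measure StateSpace) =
        (∫ p, g p ∂(m : Measure StateSpace)) + ∫ p, h p ∂(m : Measure StateSpace) :=
      integral_add (g.integrable _) (h.integrable _)
    rw [ContinuousMap.mul_apply, pairCharacter_apply, pairCharacter_apply, pairCharacter_apply,
      ← Complex.exp_add, hint]
    congr 1
    push_cast
    ring

lemma star_mem_pairCharacters {χ : C(FiniteMeasure StateSpace × ℝ, ℂ)}
    (hχ : χ ∈ pairCharacters) : star χ ∈ pairCharacters := by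
  obtain ⟨g, u, rfl⟩ := hχ
  refine ⟨-g, -u, ?_⟩
  ext ⟨m, z⟩
  have hint : ∫ p, (-g) p ∂(m : Measure StateSpace) = -∫ p, g p ∂(m : Measure StateSpace) :=
    integral_neg _
  rw [ContinuousMap.star_apply, pairCharacter_apply, pairCharacter_apply, hint, Complex.star_def,
    ← Complex.exp_conj, map_mul, Complex.conj_I, Complex.conj_ofReal]
  congr 1
  push_cast
  ring

lemma exists_exp_mul_I_ne {y : ℝ} (hy : y ≠ 0) :
    ∃ c : ℝ, Complex.exp (((c * y : ℝ) : ℂ) * Complex.I) ≠ 1 := by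
  refine ⟨Real.pi / y, ?_⟩
  rw [div_mul_cancel₀ _ hy, Complex.exp_pi_mul_I]
  norm_num

/-- Distinct values of `∫ g dm + u z` suffice, since scaling `(g, u)` turns their difference into
the phase `π`. Such values come from `(0, 1)` if only the real coordinates differ, and otherwise
from some `g`, as integrals of bounded continuous functions determine a finite measure. -/
lemma pairCharacters_separate {p q : FiniteMeasure StateSpace × ℝ} (hpq : p ≠ q) :
    ∃ χ ∈ pairCharacters, χ p ≠ χ q := by
  obtain ⟨m, y⟩ := p
  obtain ⟨m', z⟩ := q
  have key : ∀ (g : BoundedContinuousFunction StateSpace ℝ) (u : ℝ),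
      (∫ p, g p ∂(m : Measure StateSpace)) + u * y ≠
        (∫ p, g p ∂(m' : Measure StateSpace)) + u * z →
      ∃ χ ∈ pairCharacters, χ (m, y) ≠ χ (m', z) := by
    intro g u hne
    obtain ⟨c, hc⟩ := exists_exp_mul_I_ne (sub_ne_zero.2 hne)
    refine ⟨_, ⟨c • g, c * u, rfl⟩, fun h => hc ?_⟩
    have hint : ∀ m : FiniteMeasure StateSpace, ∫ p, (c • g) p ∂(m : Measure StateSpace) =
        c * ∫ p, g p ∂(m : Measure StateSpace) := fun m => integral_const_mul c _
    rw [pairCharacter_apply, pairCharacter_apply, hint, hint] at h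
    rw [mul_sub, Complex.ofReal_sub, sub_mul, Complex.exp_sub, div_eq_one_iff_eq
      (Complex.exp_ne_zero _)]
    convert h using 4 <;> ring
  by_cases hm : m = m'
  · subst hm
    refine key 0 1 fun h => hpq ?_
    rw [one_mul, one_mul, add_right_inj] at h
    rw [h]
  · by_contra hcon
    refine hm (FiniteMeasure.ext_of_forall_integral_eq fun g => ?_)
    by_contra hg
    exact hcon (key g 0 (by simpa using hg))

end Character

/-! ### The point processes as sums of clusters -/

section Representation

variable {Ω : Type*} {r : ℕ}

/-- The levels exceeded by `y`. -/
noncomputable def exceededLevels (a b : ℕ → ℝ) (x : Fin (r + 1) → ℝ) (n : ℕ) (y : ℝ) :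
    Finset (Fin (r + 1)) :=
  Finset.univ.filter fun j => level a b n (x j) < y

open scoped Classical in
/-- The levels at which a point with thinning variables `v` is present. -/
noncomputable def survivedLevels (G : ℝ → ℝ) (x : Fin (r + 1) → ℝ) (v : Fin r → TimeInterval) :
    Finset (Fin (r + 1)) :=
  Finset.univ.filter fun j => SurvivesTo G x v j

/-- Grouping by time instead of level yields a sum over the independent variables. -/
lemma exceedanceProcess_eq (X : ℕ → Ω → ℝ) (a b : ℕ → ℝ) (x : Fin (r + 1) → ℝ) (n : ℕ) (ω : Ω) :
    exceedanceProcess X a b x n ω =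
      ∑ i : Fin n, clusterMeasure (exceededLevels a b x n (X i ω)) (scaledTime i) := by
  unfold exceedanceProcess
  rw [Finset.sum_comm]
  refine Finset.sum_congr rfl fun i _ => ?_
  rw [clusterMeasure, exceededLevels, Finset.sum_filter]

lemma limitProcess_eq (G : ℝ → ℝ) (x : Fin (r + 1) → ℝ) (ζ : ThinningSpace r) :
    limitProcess G x ζ =
      ∑ i : Fin ζ.1, clusterMeasure (survivedLevels G x (ζ.2.2 i)) (ζ.2.1 i) := by
  unfold limitProcess thinnedPoisson
  rw [Finset.sum_comm, Finset.sum_range]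
  refine Finset.sum_congr rfl fun i _ => ?_
  rw [clusterMeasure, survivedLevels, Finset.sum_filter]

lemma measurableSet_exceededLevels (a b : ℕ → ℝ) (x : Fin (r + 1) → ℝ) (n : ℕ)
    (A : Finset (Fin (r + 1))) : MeasurableSet {y | exceededLevels a b x n y = A} := by
  have h : {y | exceededLevels a b x n y = A} =
      ⋂ j, {y | level a b n (x j) < y ↔ j ∈ A} := by
    ext y
    simp [exceededLevels, Finset.ext_iff]
  rw [h]
  refine MeasurableSet.iInter fun j => ?_
  by_cases hj : j ∈ A
  · simp only [hj, iff_true]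
    exact measurableSet_Ioi
  · simp only [hj, iff_false, not_lt]
    exact measurableSet_Iic

lemma measurableSet_survivesTo (G : ℝ → ℝ) (x : Fin (r + 1) → ℝ) (j : Fin (r + 1)) :
    MeasurableSet {v : Fin r → TimeInterval | SurvivesTo G x v j} := by
  simp only [SurvivesTo, Set.ofPred_forall]
  refine MeasurableSet.iInter fun m => MeasurableSet.iInter fun _ => ?_
  exact measurableSet_le (measurable_subtype_coe.comp (measurable_pi_apply m)) measurable_const

lemma measurableSet_survivedLevels (G : ℝ → ℝ) (x : Fin (r + 1) → ℝ)
    (A : Finset (Fin (r + 1))) : MeasurableSet {v | survivedLevels G x v = A} := by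
  have h : {v | survivedLevels G x v = A} = ⋂ j, {v | SurvivesTo G x v j ↔ j ∈ A} := by
    ext v
    simp [survivedLevels, Finset.ext_iff]
  rw [h]
  refine MeasurableSet.iInter fun j => ?_
  by_cases hj : j ∈ A
  · simp only [hj, iff_true]
    exact measurableSet_survivesTo G x j
  · simp only [hj, iff_false]
    exact (measurableSet_survivesTo G x j).compl

/-- A function that is continuous on each of countably many measurable pieces is Borel
measurable. -/
lemma measurable_borel_of_pieces {X Y ι : Type*} [TopologicalSpace X] [MeasurableSpace Ω]
    [TopologicalSpace Y] [MeasurableSpace Y] [OpensMeasurableSpace Y] [Countable ι]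
    {L : Ω → ι} (hL : ∀ l, MeasurableSet {ω | L ω = l}) {η : Ω → Y} (hη : Measurable η)
    {F : ι → Y → X} (hF : ∀ l, Continuous (F l)) :
    Measurable[_, borel X] fun ω => F (L ω) (η ω) := by
  refine measurable_generateFrom fun U hU => ?_
  have h : (fun ω => F (L ω) (η ω)) ⁻¹' U = ⋃ l, {ω | L ω = l} ∩ η ⁻¹' (F l ⁻¹' U) := by
    ext ω
    simp
  rw [h]
  exact MeasurableSet.iUnion fun l => (hL l).inter (hη ((hF l).isOpen_preimage U hU).measurableSet)

/-- The Borel `σ`-algebra of the product space may be larger than the product `σ`-algebra, so the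
pair is treated as a whole: on each of the finitely many mark patterns it is a continuous function
of `S`. -/
lemma measurable_exceedanceProcess_pair [MeasurableSpace Ω] {X : ℕ → Ω → ℝ}
    (hX : ∀ i, Measurable (X i)) (a b : ℕ → ℝ) (x : Fin (r + 1) → ℝ) (n : ℕ) {S : Ω → ℝ}
    (hS : Measurable S) :
    Measurable[_, borel (FiniteMeasure StateSpace × ℝ)] fun ω =>
      (exceedanceProcess X a b x n ω, S ω) := by
  simp only [exceedanceProcess_eq]
  refine measurable_borel_of_pieces
    (L := fun ω => fun i : Fin n => exceededLevels a b x n (X i ω)) (fun l => ?_) hS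
    (F := fun l z => (∑ i : Fin n, clusterMeasure (l i) (scaledTime i), z)) (fun l => by fun_prop)
  have h : {ω | (fun i : Fin n => exceededLevels a b x n (X i ω)) = l} =
      ⋂ i : Fin n, X i ⁻¹' {y | exceededLevels a b x n y = l i} := by
    ext ω
    simp [funext_iff]
  rw [h]
  exact MeasurableSet.iInter fun i => hX i (measurableSet_exceededLevels a b x n (l i))

lemma measurable_limitProcess_pair (G : ℝ → ℝ) (x : Fin (r + 1) → ℝ) :
    Measurable[_, borel (FiniteMeasure StateSpace × ℝ)] fun p : ThinningSpace r × ℝ =>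
      (limitProcess G x p.1, p.2) := by
  simp only [limitProcess_eq]
  refine measurable_borel_of_pieces
    -- The piece is indexed by the number of points together with their marks, a countable type. On
    -- it the process depends continuously on the positions.
    (L := fun p : ThinningSpace r × ℝ =>
      (⟨p.1.1, fun i => survivedLevels G x (p.1.2.2 i)⟩ :
        Σ k : ℕ, (Fin k → Finset (Fin (r + 1))))) (fun l => ?_)
    (η := fun p : ThinningSpace r × ℝ => (p.1.2.1, p.2)) (by fun_prop)
    (F := fun l q => (∑ i : Fin l.1, clusterMeasure (l.2 i) (q.1 i), q.2)) (fun l => ?_)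
  · obtain ⟨k, s⟩ := l
    have h : {p : ThinningSpace r × ℝ | (⟨p.1.1, fun i => survivedLevels G x (p.1.2.2 i)⟩ :
        Σ k : ℕ, (Fin k → Finset (Fin (r + 1)))) = ⟨k, s⟩} =
        (fun p => p.1.1) ⁻¹' {k} ∩
          ⋂ i : Fin k, (fun p => p.1.2.2 i) ⁻¹' {v | survivedLevels G x v = s i} := by
      ext ⟨⟨κ, U, V⟩, z⟩
      simp only [Set.mem_ofPred_eq, Set.mem_inter_iff, Set.mem_preimage, Set.mem_singleton_iff,
        Set.mem_iInter]
      constructor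
      · intro h
        obtain ⟨rfl, h⟩ := Sigma.mk.inj_iff.1 h
        exact ⟨rfl, fun i => congrFun (eq_of_heq h) i⟩
      · rintro ⟨rfl, h⟩
        congr
        exact funext h
    rw [h]
    refine MeasurableSet.inter ?_ (MeasurableSet.iInter fun i => ?_)
    · exact (show Measurable fun p : ThinningSpace r × ℝ => p.1.1 by fun_prop)
        (measurableSet_singleton k)
    · exact (show Measurable fun p : ThinningSpace r × ℝ => p.1.2.2 i by fun_prop)
        (measurableSet_survivedLevels G x (s i))
  · refine Continuous.prodMk (continuous_finsetSum _ fun i _ => ?_) continuous_snd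
    exact (continuous_clusterMeasure _).comp (by fun_prop)

end Representation

/-! ### Products of factors close to one -/

section Products

/-- The factors are exchanged one at a time; the untouched ones have modulus at most one. -/
lemma norm_prod_sub_prod_le_sum {ι : Type*} (s : Finset ι) {a b : ι → ℂ}
    (ha : ∀ i ∈ s, ‖a i‖ ≤ 1) (hb : ∀ i ∈ s, ‖b i‖ ≤ 1) :
    ‖∏ i ∈ s, a i - ∏ i ∈ s, b i‖ ≤ ∑ i ∈ s, ‖a i - b i‖ := by
  classical
  induction s using Finset.induction_on with
  | empty => simp
  | insert i s hi ih =>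
    rw [Finset.prod_insert hi, Finset.prod_insert hi, Finset.sum_insert hi]
    have hs := ih (fun k hk => ha k (Finset.mem_insert_of_mem hk))
      (fun k hk => hb k (Finset.mem_insert_of_mem hk))
    have hprod : ‖∏ k ∈ s, a k‖ ≤ 1 := by
      rw [norm_prod]
      exact Finset.prod_le_one (fun k _ => norm_nonneg _)
        fun k hk => ha k (Finset.mem_insert_of_mem hk)
    calc ‖a i * ∏ k ∈ s, a k - b i * ∏ k ∈ s, b k‖
        = ‖(a i - b i) * ∏ k ∈ s, a k + b i * (∏ k ∈ s, a k - ∏ k ∈ s, b k)‖ := by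
          congr 1; ring
      _ ≤ ‖a i - b i‖ * ‖∏ k ∈ s, a k‖ + ‖b i‖ * ‖∏ k ∈ s, a k - ∏ k ∈ s, b k‖ := by
          refine (norm_add_le _ _).trans ?_
          rw [norm_mul, norm_mul]
      _ ≤ ‖a i - b i‖ * 1 + 1 * ∑ k ∈ s, ‖a k - b k‖ := by
          gcongr
          exact hb i (Finset.mem_insert_self i s)
      _ = _ := by ring

/-- A product of `n` factors `1 + c` of modulus at most one with `c = O(1/n)` converges to the
exponential of the limit of the sum of the `c`. -/
lemma tendsto_prod_one_add_of_tendsto_sum {c : (n : ℕ) → Fin n → ℂ} {C : ℝ} {L : ℂ}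
    (hle : ∀ n i, ‖1 + c n i‖ ≤ 1) (hC : ∀ᶠ n : ℕ in atTop, ∀ i, ‖c n i‖ ≤ C / n)
    (hsum : Tendsto (fun n => ∑ i, c n i) atTop (𝓝 L)) :
    Tendsto (fun n => ∏ i, (1 + c n i)) atTop (𝓝 (Complex.exp L)) := by
  have hexp : Tendsto (fun n => ∏ i, Complex.exp (c n i)) atTop (𝓝 (Complex.exp L)) := by
    simp_rw [← Complex.exp_sum]
    exact (Complex.continuous_exp.tendsto L).comp hsum
  have hdiff : Tendsto (fun n => ∏ i, (1 + c n i) - ∏ i, Complex.exp (c n i)) atTop (𝓝 0) := by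
    have hz : Tendsto (fun n : ℕ => C ^ 2 / n) atTop (𝓝 0) :=
      tendsto_const_div_atTop_nhds_zero_nat _
    have hlarge : ∀ᶠ n : ℕ in atTop, C ≤ n := tendsto_natCast_atTop_atTop.eventually_ge_atTop C
    refine squeeze_zero_norm' ?_ hz
    filter_upwards [hC, hlarge, eventually_gt_atTop 0] with n hn hCn hpos
    have hpos' : (0 : ℝ) < n := by exact_mod_cast hpos
    have hone : ∀ i, ‖c n i‖ ≤ 1 := fun i => (hn i).trans ((div_le_one hpos').2 hCn)
    -- The modulus is `exp (Re c)`, and `1 + Re c ≤ ‖1 + c‖ ≤ 1` forces `Re c ≤ 0`.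
    have hexp_le : ∀ i, ‖Complex.exp (c n i)‖ ≤ 1 := fun i => by
      rw [Complex.norm_exp, Real.exp_le_one_iff]
      have h1 := (Complex.re_le_norm (1 + c n i)).trans (hle n i)
      simpa using h1
    calc ‖∏ i, (1 + c n i) - ∏ i, Complex.exp (c n i)‖
        ≤ ∑ i, ‖1 + c n i - Complex.exp (c n i)‖ :=
          norm_prod_sub_prod_le_sum _ (fun i _ => hle n i) (fun i _ => hexp_le i)
      _ ≤ ∑ _i : Fin n, (C / n) ^ 2 := by
          refine Finset.sum_le_sum fun i _ => ?_
          rw [norm_sub_rev, ← sub_sub]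
          exact (Complex.norm_exp_sub_one_sub_id_le (hone i)).trans
            (pow_le_pow_left₀ (norm_nonneg _) (hn i) 2)
      _ = C ^ 2 / n := by
          rw [Finset.sum_const, Finset.card_univ, Fintype.card_fin, nsmul_eq_mul]
          field_simp
  simpa using hdiff.add hexp

end Products

/-! ### Riemann sums -/

section RiemannSum

lemma uniformTime_real_Ioc {u v : ℝ} (hu : 0 ≤ u) (huv : u ≤ v) (hv : v ≤ 1) :
    uniformTime.real {t : TimeInterval | u < t ∧ (t : ℝ) ≤ v} = v - u := by
  have himg : Subtype.val '' {t : TimeInterval | u < t ∧ (t : ℝ) ≤ v} = Set.Ioc u v := by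
    ext t
    constructor
    · rintro ⟨s, hs, rfl⟩
      exact hs
    · intro ht
      exact ⟨⟨t, hu.trans_lt ht.1, ht.2.trans hv⟩, ht, rfl⟩
  rw [measureReal_def, uniformTime, comap_subtype_coe_apply measurableSet_Ioc, himg,
    Real.volume_Ioc, ENNReal.toReal_ofReal (sub_nonneg.2 huv)]

lemma uniformTime_real_le {v : ℝ} (h0 : 0 ≤ v) (h1 : v ≤ 1) :
    uniformTime.real {t : TimeInterval | (t : ℝ) ≤ v} = v := by
  have h : {t : TimeInterval | (t : ℝ) ≤ v} = {t : TimeInterval | 0 < (t : ℝ) ∧ (t : ℝ) ≤ v} := by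
    ext t
    exact ⟨fun ht => ⟨t.2.1, ht⟩, fun ht => ht.2⟩
  rw [h, uniformTime_real_Ioc le_rfl h0 h1, sub_zero]

/-- The index of the interval `(i/n, (i+1)/n]` that contains `t`. -/
noncomputable def timeCell (n : ℕ) [NeZero n] (t : TimeInterval) : Fin n :=
  ⟨⌈(n : ℝ) * t⌉₊ - 1, by
    have hn : (0 : ℝ) < n := by exact_mod_cast NeZero.pos n
    have h1 : ⌈(n : ℝ) * t⌉₊ ≤ n := Nat.ceil_le.2 (mul_le_of_le_one_right hn.le t.2.2)
    have h2 : 0 < n := NeZero.pos n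
    omega⟩

lemma timeCell_val_add_one (n : ℕ) [NeZero n] (t : TimeInterval) :
    ((timeCell n t : ℕ) : ℝ) + 1 = (⌈(n : ℝ) * t⌉₊ : ℝ) := by
  have hn : (0 : ℝ) < n := by exact_mod_cast NeZero.pos n
  have h1 : 0 < ⌈(n : ℝ) * t⌉₊ := Nat.ceil_pos.2 (mul_pos hn t.2.1)
  have h2 : (timeCell n t : ℕ) + 1 = ⌈(n : ℝ) * t⌉₊ := Nat.sub_add_cancel h1
  exact_mod_cast h2

lemma timeCell_eq_iff (n : ℕ) [NeZero n] (t : TimeInterval) (i : Fin n) :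
    timeCell n t = i ↔ (i : ℝ) / n < t ∧ (t : ℝ) ≤ ((i : ℝ) + 1) / n := by
  have hn : (0 : ℝ) < n := by exact_mod_cast NeZero.pos n
  rw [div_lt_iff₀ hn, le_div_iff₀ hn, mul_comm (t : ℝ)]
  have h : timeCell n t = i ↔ ⌈(n : ℝ) * t⌉₊ = (i : ℕ) + 1 := by
    rw [Fin.ext_iff, ← Nat.add_right_cancel_iff (n := 1)]
    have := timeCell_val_add_one n t
    have h2 : (timeCell n t : ℕ) + 1 = ⌈(n : ℝ) * t⌉₊ := by exact_mod_cast this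
    rw [h2]
  rw [h, Nat.ceil_eq_iff (Nat.succ_ne_zero _)]
  push_cast
  simp

lemma measurable_timeCell (n : ℕ) [NeZero n] : Measurable (timeCell n) := by
  refine measurable_to_countable' fun i => ?_
  have h : timeCell n ⁻¹' {i} = {t : TimeInterval | (i : ℝ) / n < t ∧ (t : ℝ) ≤ ((i : ℝ) + 1) / n} := by
    ext t
    exact timeCell_eq_iff n t i
  rw [h]
  exact (measurableSet_lt measurable_const measurable_subtype_coe).inter
    (measurableSet_le measurable_subtype_coe measurable_const)

lemma uniformTime_real_timeCell (n : ℕ) [NeZero n] (i : Fin n) :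
    uniformTime.real (timeCell n ⁻¹' {i}) = 1 / n := by
  have hn : (0 : ℝ) < n := by exact_mod_cast NeZero.pos n
  have hi : ((i : ℕ) : ℝ) + 1 ≤ n := by exact_mod_cast i.isLt
  have h : timeCell n ⁻¹' {i} = {t : TimeInterval | (i : ℝ) / n < t ∧ (t : ℝ) ≤ ((i : ℝ) + 1) / n} := by
    ext t
    exact timeCell_eq_iff n t i
  rw [h, uniformTime_real_Ioc (by positivity) (by gcongr; linarith) ((div_le_one hn).2 hi)]
  ring

/-- Writes a Riemann sum as the integral of a step function, so that dominated convergence applies.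
-/
lemma integral_comp_timeCell (n : ℕ) [NeZero n] (f : Fin n → ℂ) :
    ∫ t, f (timeCell n t) ∂uniformTime = (1 / n : ℝ) • ∑ i, f i := by
  have hprob : IsProbabilityMeasure (uniformTime.map (timeCell n)) :=
    Measure.isProbabilityMeasure_map (measurable_timeCell n).aemeasurable
  rw [← integral_map (f := f) (measurable_timeCell n).aemeasurable
    (measurable_of_finite f).aestronglyMeasurable, integral_fintype (Integrable.of_finite),
    Finset.smul_sum]
  refine Finset.sum_congr rfl fun i _ => ?_
  rw [map_measureReal_apply (measurable_timeCell n) (measurableSet_singleton i),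
    uniformTime_real_timeCell]

lemma tendsto_scaledTime_timeCell (t : TimeInterval) :
    Tendsto (fun n : ℕ => scaledTime (timeCell (n + 1) t)) atTop (𝓝 t) := by
  rw [tendsto_subtype_rng, tendsto_iff_norm_sub_tendsto_zero]
  refine squeeze_zero (fun n => norm_nonneg _) (fun n => ?_)
    (tendsto_one_div_add_atTop_nhds_zero_nat (𝕜 := ℝ))
  have hn : (0 : ℝ) < ((n + 1 : ℕ) : ℝ) := by positivity
  have hpos : 0 ≤ ((n + 1 : ℕ) : ℝ) * t := mul_nonneg hn.le t.2.1.le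
  change ‖((timeCell (n + 1) t : ℕ) + 1 : ℝ) / ((n + 1 : ℕ) : ℝ) - t‖ ≤ _
  rw [timeCell_val_add_one, Real.norm_eq_abs, abs_le]
  have h1 := Nat.le_ceil (((n + 1 : ℕ) : ℝ) * (t : ℝ))
  have h2 := (Nat.ceil_lt_add_one hpos).le
  have h3 : (1 : ℝ) / ((n : ℝ) + 1) = 1 / ((n + 1 : ℕ) : ℝ) := by push_cast; ring
  rw [h3]
  constructor
  · have : (t : ℝ) ≤ (⌈((n + 1 : ℕ) : ℝ) * (t : ℝ)⌉₊ : ℝ) / ((n + 1 : ℕ) : ℝ) := by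
      rw [le_div_iff₀ hn]; linarith
    have : 0 < 1 / ((n + 1 : ℕ) : ℝ) := by positivity
    linarith
  · rw [sub_le_iff_le_add, div_le_iff₀ hn, add_mul, div_mul_cancel₀ _ hn.ne']
    linarith

/-- Riemann sums of a bounded continuous function on `(0,1]`. -/
lemma tendsto_riemannSum {f : TimeInterval → ℂ} (hf : Continuous f) {C : ℝ}
    (hC : ∀ t, ‖f t‖ ≤ C) :
    Tendsto (fun n : ℕ => (1 / n : ℝ) • ∑ i : Fin n, f (scaledTime i)) atTop
      (𝓝 (∫ t, f t ∂uniformTime)) := by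
  -- Shifting the index avoids `n = 0`, for which there are no cells.
  rw [← tendsto_add_atTop_iff_nat 1]
  have h : ∀ n : ℕ, (1 / (n + 1 : ℕ) : ℝ) • ∑ i : Fin (n + 1), f (scaledTime i) =
      ∫ t, f (scaledTime (timeCell (n + 1) t)) ∂uniformTime := fun n =>
    (integral_comp_timeCell (n + 1) fun i => f (scaledTime i)).symm
  simp_rw [h]
  refine tendsto_integral_of_dominated_convergence (fun _ => C) (fun n => ?_)
    (integrable_const C) (fun n => Eventually.of_forall fun t => hC _)
    (Eventually.of_forall fun t => (hf.tendsto t).comp (tendsto_scaledTime_timeCell t))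
  exact ((measurable_of_finite fun i : Fin (n + 1) => f (scaledTime i)).comp
    (measurable_timeCell (n + 1))).aestronglyMeasurable

end RiemannSum

/-! ### Rare events -/

section RareEvents

lemma tendsto_zero_of_tendsto_natCast_mul {p : ℕ → ℝ} {τ : ℝ}
    (h : Tendsto (fun n : ℕ => n * p n) atTop (𝓝 τ)) : Tendsto p atTop (𝓝 0) := by
  have h1 := (tendsto_one_div_atTop_nhds_zero_nat (𝕜 := ℝ)).mul h
  rw [zero_mul] at h1
  refine h1.congr' ?_
  filter_upwards [eventually_gt_atTop 0] with n hn
  have : (n : ℝ) ≠ 0 := by exact_mod_cast hn.ne'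
  field_simp

/-- If `(1 - p_n)^n → q > 0` then `n p_n → -log q`. -/
lemma tendsto_natCast_mul_of_tendsto_one_sub_pow {p : ℕ → ℝ}
    (h1 : ∀ n, p n ≤ 1) {q : ℝ} (hq : 0 < q)
    (h : Tendsto (fun n => (1 - p n) ^ n) atTop (𝓝 q)) :
    Tendsto (fun n : ℕ => n * p n) atTop (𝓝 (-Real.log q)) := by
  have hlog : Tendsto (fun n : ℕ => n * -Real.log (1 - p n)) atTop (𝓝 (-Real.log q)) := by
    refine ((Real.continuousAt_log hq.ne').tendsto.comp h).neg.congr fun n => ?_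
    simp [Real.log_pow]
  -- If `1 - p n` vanished, so would its power for `n > 0`, against the positive limit.
  have hpos : ∀ᶠ n in atTop, 0 < 1 - p n := by
    filter_upwards [h.eventually (lt_mem_nhds hq), eventually_gt_atTop 0] with n hn hn0
    refine lt_of_le_of_ne (sub_nonneg.2 (h1 n)) fun heq => ?_
    rw [← heq, zero_pow hn0.ne'] at hn
    exact lt_irrefl _ hn
  have hzero := tendsto_zero_of_tendsto_natCast_mul hlog
  have hone : Tendsto (fun n => 1 - p n) atTop (𝓝 1) := by
    have h2 := (Real.continuous_exp.tendsto 0).comp (neg_zero (G := ℝ) ▸ hzero.neg)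
    rw [Real.exp_zero] at h2
    refine h2.congr' ?_
    filter_upwards [hpos] with n hn
    simp [Real.exp_log hn]
  -- Squeeze from `-(1 - p) log (1 - p) ≤ p ≤ -log (1 - p)`.
  have hlow : Tendsto (fun n : ℕ => (n * -Real.log (1 - p n)) * (1 - p n)) atTop
      (𝓝 (-Real.log q)) := by
    simpa using hlog.mul hone
  refine tendsto_of_tendsto_of_tendsto_of_le_of_le' hlow hlog ?_ ?_
  · filter_upwards [hpos] with n hn
    rw [mul_assoc]
    refine mul_le_mul_of_nonneg_left ?_ (Nat.cast_nonneg n)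
    have h3 := Real.one_sub_inv_le_log_of_pos hn
    have h4 : (1 - (1 - p n)⁻¹) * (1 - p n) = -p n := by field_simp; ring
    have h5 := mul_le_mul_of_nonneg_right h3 hn.le
    linarith
  · filter_upwards [hpos] with n hn
    refine mul_le_mul_of_nonneg_left ?_ (Nat.cast_nonneg n)
    have h3 := Real.log_le_sub_one_of_pos hn
    linarith

variable {μ : Measure ℝ} [IsProbabilityMeasure μ]

lemma integrable_abs_of_integrable_sq (hsq : Integrable (fun y : ℝ => y ^ 2) μ) :
    Integrable (fun y : ℝ => |y|) μ := by
  refine Integrable.mono' ((integrable_const 1).add hsq) (by fun_prop)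
    (Eventually.of_forall fun y => ?_)
  rw [Real.norm_eq_abs, abs_abs, Pi.add_apply]
  nlinarith [sq_nonneg (|y| - 1), sq_abs y]

/-- The contribution of events of probability `O(1/n)` to the first absolute moment is
`o(1/√n)`. -/
lemma tendsto_sqrt_mul_setIntegral_abs (hsq : Integrable (fun y : ℝ => y ^ 2) μ)
    {E : ℕ → Set ℝ} (hE : ∀ n, MeasurableSet (E n)) {τ : ℝ}
    (hτ : Tendsto (fun n : ℕ => n * μ.real (E n)) atTop (𝓝 τ)) :
    Tendsto (fun n : ℕ => Real.sqrt n * ∫ y in E n, |y| ∂μ) atTop (𝓝 0) := by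
  have hμ : Tendsto (fun n => μ (E n)) atTop (𝓝 0) := by
    have h := ENNReal.tendsto_ofReal (tendsto_zero_of_tendsto_natCast_mul hτ)
    simpa [ofReal_measureReal] using h
  have hJ : Tendsto (fun n => ∫ y in E n, y ^ 2 ∂μ) atTop (𝓝 0) :=
    hsq.tendsto_setIntegral_nhds_zero hμ
  have habs := integrable_abs_of_integrable_sq hsq
  rw [Metric.tendsto_atTop]
  intro η hη
  -- The choice balances `√n |y| ≤ ε n + ε⁻¹ y²` on `E n`: the first term integrates to at most `ε
  -- (|τ| + 1) = η / 2`, and the second is eventually below `η / 2` because the second moment over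
  -- `E n` vanishes.
  set ε : ℝ := η / (2 * (|τ| + 1)) with hε
  have hεpos : 0 < ε := by positivity
  have hev : ∀ᶠ n : ℕ in atTop, n * μ.real (E n) < |τ| + 1 :=
    hτ.eventually_lt_const (lt_of_le_of_lt (le_abs_self τ) (lt_add_one _))
  have hev2 : ∀ᶠ n : ℕ in atTop, ∫ y in E n, y ^ 2 ∂μ < ε * (η / 2) :=
    hJ.eventually_lt_const (by positivity)
  refine eventually_atTop.1 ?_
  filter_upwards [hev, hev2] with n hn1 hn2
  have hnn : 0 ≤ ∫ y in E n, |y| ∂μ := setIntegral_nonneg (hE n) fun y _ => abs_nonneg y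
  rw [dist_zero_right, Real.norm_eq_abs, abs_of_nonneg (mul_nonneg (Real.sqrt_nonneg _) hnn)]
  calc Real.sqrt n * ∫ y in E n, |y| ∂μ = ∫ y in E n, Real.sqrt n * |y| ∂μ :=
        (integral_const_mul _ _).symm
    _ ≤ ∫ y in E n, (ε * n + ε⁻¹ * y ^ 2) ∂μ := by
        refine setIntegral_mono (habs.const_mul _).integrableOn
          ((integrable_const _).add (hsq.const_mul _)).integrableOn fun y => ?_
        have h1 : Real.sqrt n ^ 2 = n := Real.sq_sqrt (Nat.cast_nonneg n)
        have h2 : 0 ≤ ε⁻¹ * (ε * Real.sqrt n - |y|) ^ 2 := by positivity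
        have h3 : ε⁻¹ * (ε * Real.sqrt n - |y|) ^ 2 =
            ε * Real.sqrt n ^ 2 - 2 * (Real.sqrt n * |y|) + ε⁻¹ * y ^ 2 := by
          rw [← sq_abs y]
          generalize Real.sqrt n = s
          generalize |y| = w
          field_simp
          ring
        have h4 : 0 ≤ Real.sqrt n * |y| := by positivity
        rw [h1] at h3
        simp only
        linarith
    _ = ε * (n * μ.real (E n)) + ε⁻¹ * ∫ y in E n, y ^ 2 ∂μ := by
        rw [integral_add (integrable_const _) (hsq.const_mul _).integrableOn, integral_const_mul ε⁻¹]
        simp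
        ring
    _ < ε * (|τ| + 1) + ε⁻¹ * (ε * (η / 2)) := by gcongr
    _ = η := by
        rw [inv_mul_cancel_left₀ hεpos.ne', hε]
        field_simp
        ring

/-- The Taylor expansion of the characteristic function of a standardized distribution. -/
lemma tendsto_natCast_mul_charFun_sub_one (hmean : ∫ y, y ∂μ = 0) (hvar : ∫ y, y ^ 2 ∂μ = 1)
    (u : ℝ) : Tendsto (fun n : ℕ => (n : ℂ) * (charFun μ (u / Real.sqrt n) - 1)) atTop
      (𝓝 (-(u : ℂ) ^ 2 / 2)) := by
  have hzero : Tendsto (fun n : ℕ => u / Real.sqrt n) atTop (𝓝 0) :=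
    tendsto_const_nhds.div_atTop (Real.tendsto_sqrt_atTop.comp tendsto_natCast_atTop_atTop)
  have ht := (taylor_charFun_two (P := μ) (X := id) aemeasurable_id hmean hvar).comp_tendsto hzero
  rw [Measure.map_id] at ht
  have ht2 : Tendsto (fun n : ℕ => (n : ℂ) * (charFun μ (u / Real.sqrt n) -
      (1 - ((u / Real.sqrt n : ℝ) : ℂ) ^ 2 / 2))) atTop (𝓝 0) := by
    rw [Asymptotics.isLittleO_iff] at ht
    rw [Metric.tendsto_atTop]
    intro ε hε
    -- Adding one keeps the divisor positive when `u = 0`.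
    have hu : 0 < u ^ 2 + 1 := by positivity
    obtain ⟨N, hN⟩ := eventually_atTop.1 (ht (c := ε / (u ^ 2 + 1)) (by positivity))
    refine ⟨max N 1, fun n hn => ?_⟩
    have hn0 : (0 : ℝ) < n := by
      exact_mod_cast Nat.lt_of_lt_of_le Nat.one_pos (le_of_max_le_right hn)
    have h := hN n (le_of_max_le_left hn)
    simp only [Function.comp_apply] at h
    rw [dist_zero_right, norm_mul, Complex.norm_natCast]
    calc (n : ℝ) * ‖charFun μ (u / Real.sqrt n) - (1 - ((u / Real.sqrt n : ℝ) : ℂ) ^ 2 / 2)‖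
        ≤ n * (ε / (u ^ 2 + 1) * ‖(u / Real.sqrt n) ^ 2‖) := by gcongr
      _ = ε * (u ^ 2 / (u ^ 2 + 1)) := by
          rw [Real.norm_of_nonneg (sq_nonneg _), div_pow, Real.sq_sqrt hn0.le]
          field_simp
      _ < ε * 1 := by
          gcongr
          rw [div_lt_one hu]
          linarith
      _ = ε := mul_one ε
  have ht3 := ht2.add_const (-(u : ℂ) ^ 2 / 2)
  rw [zero_add] at ht3
  refine ht3.congr' ?_
  filter_upwards [eventually_gt_atTop 0] with n hn
  have hn0 : (0 : ℝ) < n := by exact_mod_cast hn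
  have hsqrt : ((Real.sqrt n : ℝ) : ℂ) ^ 2 = n := by
    rw [← Complex.ofReal_pow, Real.sq_sqrt hn0.le, Complex.ofReal_natCast]
  have hne : (n : ℂ) ≠ 0 := by exact_mod_cast hn.ne'
  rw [Complex.ofReal_div, div_pow, hsqrt]
  field_simp
  ring

end RareEvents

/-! ### The limit of the joint characteristic functional -/

section CharacteristicFunctional

lemma norm_exp_ofReal_mul_I_sub_one_le (y : ℝ) : ‖Complex.exp ((y : ℂ) * Complex.I) - 1‖ ≤ |y| := by
  rw [mul_comm]
  exact Real.norm_exp_I_mul_ofReal_sub_one_le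

lemma norm_exp_ofReal_mul_I_sub_one_le_two (y : ℝ) :
    ‖Complex.exp ((y : ℂ) * Complex.I) - 1‖ ≤ 2 := by
  refine (norm_sub_le _ _).trans ?_
  rw [Complex.norm_exp_ofReal_mul_I, norm_one]
  norm_num

lemma integrable_exp_ofReal_mul_I {α : Type*} [MeasurableSpace α] {μ : Measure α}
    [IsFiniteMeasure μ] {f : α → ℝ} (hf : Measurable f) :
    Integrable (fun y => Complex.exp ((f y : ℂ) * Complex.I)) μ :=
  Integrable.of_bound (by fun_prop) 1
    (Eventually.of_forall fun y => (Complex.norm_exp_ofReal_mul_I _).le)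

lemma norm_integral_exp_ofReal_mul_I_le {α : Type*} [MeasurableSpace α] {μ : Measure α}
    [IsProbabilityMeasure μ] (f : α → ℝ) :
    ‖∫ y, Complex.exp ((f y : ℂ) * Complex.I) ∂μ‖ ≤ 1 := by
  refine (norm_integral_le_of_norm_le_const (C := 1)
    (Eventually.of_forall fun y => (Complex.norm_exp_ofReal_mul_I _).le)).trans ?_
  simp

lemma integral_comp_of_finite {α F : Type*} [MeasurableSpace α] {μ : Measure α}
    [IsProbabilityMeasure μ] [Fintype F] [MeasurableSpace F] [MeasurableSingletonClass F]
    {A : α → F} (hA : Measurable A) (k : F → ℂ) :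
    ∫ y, k (A y) ∂μ = ∑ f, (μ.real {y | A y = f} : ℂ) * k f := by
  have hprob : IsProbabilityMeasure (μ.map A) := Measure.isProbabilityMeasure_map hA.aemeasurable
  rw [← integral_map (f := k) hA.aemeasurable (measurable_of_finite k).aestronglyMeasurable,
    integral_fintype Integrable.of_finite]
  refine Finset.sum_congr rfl fun f _ => ?_
  rw [map_measureReal_apply hA (measurableSet_singleton f), Complex.real_smul]
  rfl

variable {μ : Measure ℝ} [IsProbabilityMeasure μ] {F : Type*} [MeasurableSpace F]
  [MeasurableSingletonClass F]

/-- Replacing the mark by the trivial one changes a characteristic function by at most twice the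
probability of a nontrivial mark. -/
lemma norm_integral_exp_sub_charFun_le [Countable F] {A : ℝ → F} (hA : Measurable A) {h : F → ℝ}
    {o : F} (ho : h o = 0) (v : ℝ) :
    ‖∫ y, Complex.exp (((h (A y) + v * y : ℝ) : ℂ) * Complex.I) ∂μ - charFun μ v‖ ≤
      2 * μ.real {y | A y ≠ o} := by
  have hhA : Measurable fun y => h (A y) := (measurable_of_countable h).comp hA
  have hm : MeasurableSet {y | A y ≠ o} := (hA (measurableSet_singleton o)).compl
  have hchar : charFun μ v = ∫ y, Complex.exp (((v * y : ℝ) : ℂ) * Complex.I) ∂μ := by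
    rw [charFun_apply_real]
    simp only [Complex.ofReal_mul]
  rw [hchar, ← integral_sub (integrable_exp_ofReal_mul_I (by fun_prop))
    (integrable_exp_ofReal_mul_I (by fun_prop))]
  calc ‖∫ y, (Complex.exp (((h (A y) + v * y : ℝ) : ℂ) * Complex.I) -
        Complex.exp (((v * y : ℝ) : ℂ) * Complex.I)) ∂μ‖
      ≤ ∫ y, {y | A y ≠ o}.indicator (fun _ => (2 : ℝ)) y ∂μ := by
        refine norm_integral_le_of_norm_le ((integrable_const _).indicator hm)
          (Eventually.of_forall fun y => ?_)
        have hfac : Complex.exp (((h (A y) + v * y : ℝ) : ℂ) * Complex.I) -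
            Complex.exp (((v * y : ℝ) : ℂ) * Complex.I) =
            (Complex.exp ((h (A y) : ℂ) * Complex.I) - 1) *
              Complex.exp (((v * y : ℝ) : ℂ) * Complex.I) := by
          rw [sub_mul, ← Complex.exp_add, one_mul]
          push_cast
          rw [add_mul]
        rw [hfac, norm_mul, Complex.norm_exp_ofReal_mul_I, mul_one]
        by_cases hy : A y = o
        · simp [hy, ho]
        · rw [Set.indicator_of_mem (show y ∈ {y | A y ≠ o} from hy)]
          exact norm_exp_ofReal_mul_I_sub_one_le_two _
    _ = 2 * μ.real {y | A y ≠ o} := by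
        rw [integral_indicator_const _ hm, smul_eq_mul, mul_comm]

/-- Up to a small error, marks and sums contribute additively to a characteristic function. -/
lemma norm_integral_exp_sub_sub_le [Countable F] {A : ℝ → F} (hA : Measurable A) {h : F → ℝ}
    {o : F} (ho : h o = 0) (habs : Integrable (fun y : ℝ => |y|) μ) (v : ℝ) :
    ‖∫ y, Complex.exp (((h (A y) + v * y : ℝ) : ℂ) * Complex.I) ∂μ - 1 - (charFun μ v - 1) -
      ∫ y, (Complex.exp ((h (A y) : ℂ) * Complex.I) - 1) ∂μ‖ ≤
      2 * |v| * ∫ y in {y | A y ≠ o}, |y| ∂μ := by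
  have hhA : Measurable fun y => h (A y) := (measurable_of_countable h).comp hA
  have hm : MeasurableSet {y | A y ≠ o} := (hA (measurableSet_singleton o)).compl
  have hchar : charFun μ v = ∫ y, Complex.exp (((v * y : ℝ) : ℂ) * Complex.I) ∂μ := by
    rw [charFun_apply_real]
    simp only [Complex.ofReal_mul]
  have hi1 := integrable_exp_ofReal_mul_I (μ := μ) (f := fun y => h (A y) + v * y) (by fun_prop)
  have hi2 := integrable_exp_ofReal_mul_I (μ := μ) (f := fun y => v * y) (by fun_prop)
  have hi3 := integrable_exp_ofReal_mul_I (μ := μ) (f := fun y => h (A y)) hhA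
  -- The identity `e^(a+b) - e^b - (e^a - 1) = (e^a - 1)(e^b - 1)`. The first factor vanishes for
  -- the trivial mark and is at most `2`; the second is at most `|v y|`.
  have heq : ∫ y, Complex.exp (((h (A y) + v * y : ℝ) : ℂ) * Complex.I) ∂μ - 1 -
      (charFun μ v - 1) - ∫ y, (Complex.exp ((h (A y) : ℂ) * Complex.I) - 1) ∂μ =
      ∫ y, (Complex.exp ((h (A y) : ℂ) * Complex.I) - 1) *
        (Complex.exp (((v * y : ℝ) : ℂ) * Complex.I) - 1) ∂μ := by
    rw [hchar, sub_sub_sub_cancel_right, ← integral_sub hi1 hi2]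
    refine (integral_sub (hi1.sub hi2) (hi3.sub (integrable_const 1))).symm.trans ?_
    refine integral_congr_ae (Eventually.of_forall fun y => ?_)
    simp only [Pi.sub_apply, Complex.ofReal_add, add_mul, Complex.exp_add]
    ring
  rw [heq, ← integral_const_mul, ← integral_indicator hm]
  refine norm_integral_le_of_norm_le ((habs.const_mul _).indicator hm)
    (Eventually.of_forall fun y => ?_)
  rw [norm_mul]
  by_cases hy : A y = o
  · simp [hy, ho]
  · rw [Set.indicator_of_mem (show y ∈ {y | A y ≠ o} from hy), mul_assoc, ← abs_mul]
    exact mul_le_mul (norm_exp_ofReal_mul_I_sub_one_le_two _) (norm_exp_ofReal_mul_I_sub_one_le _)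
      (norm_nonneg _) zero_le_two

lemma measureReal_ne_eq_sum [Fintype F] [DecidableEq F] {A : ℝ → F} (hA : Measurable A) (o : F) :
    μ.real {y | A y ≠ o} = ∑ f ∈ Finset.univ.erase o, μ.real {y | A y = f} := by
  have h : {y | A y ≠ o} = ⋃ f ∈ Finset.univ.erase o, {y | A y = f} := by
    ext y
    simp
  rw [h, measureReal_biUnion_finset]
  · intro f _ g _ hfg
    exact Set.disjoint_left.2 fun y hf hg => hfg (hf.symm.trans hg)
  · exact fun f _ => hA (measurableSet_singleton f)

lemma tendsto_natCast_mul_measureReal_ne [Fintype F] [DecidableEq F] {A : ℕ → ℝ → F}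
    (hA : ∀ n, Measurable (A n)) (o : F) {lam : F → ℝ}
    (hlam : ∀ f ≠ o, Tendsto (fun n : ℕ => n * μ.real {y | A n y = f}) atTop (𝓝 (lam f))) :
    Tendsto (fun n : ℕ => n * μ.real {y | A n y ≠ o}) atTop
      (𝓝 (∑ f ∈ Finset.univ.erase o, lam f)) := by
  refine (tendsto_finsetSum (Finset.univ.erase o)
    fun f hf => hlam f (Finset.ne_of_mem_erase hf)).congr fun n => ?_
  rw [measureReal_ne_eq_sum (hA n) o, Finset.mul_sum]

/-- The characteristic functional of a process of rare marks at the times `i/n`, jointly with the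
normalized sum, converges to the one of a Poisson process of marks and an independent normal
variable. -/
theorem tendsto_prod_integral_exp [Fintype F]
    (hsq : Integrable (fun y : ℝ => y ^ 2) μ) (hmean : ∫ y, y ∂μ = 0) (hvar : ∫ y, y ^ 2 ∂μ = 1)
    {A : ℕ → ℝ → F} (hA : ∀ n, Measurable (A n)) {o : F} {lam : F → ℝ}
    (hlam : ∀ f ≠ o, Tendsto (fun n : ℕ => n * μ.real {y | A n y = f}) atTop (𝓝 (lam f)))
    {h : F → TimeInterval → ℝ} (hh : ∀ f, Continuous (h f)) (ho : ∀ t, h o t = 0) (u : ℝ) :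
    Tendsto (fun n : ℕ => ∏ i : Fin n, ∫ y, Complex.exp
        (((h (A n y) (scaledTime i) + u / Real.sqrt n * y : ℝ) : ℂ) * Complex.I) ∂μ) atTop
      (𝓝 (Complex.exp (∑ f, (lam f : ℂ) *
        ∫ t, (Complex.exp ((h f t : ℂ) * Complex.I) - 1) ∂uniformTime - (u : ℂ) ^ 2 / 2))) := by
  classical
  set k : F → TimeInterval → ℂ := fun f t => Complex.exp ((h f t : ℂ) * Complex.I) - 1 with hk
  set φ : (n : ℕ) → Fin n → ℂ := fun n i => ∫ y, Complex.exp
    (((h (A n y) (scaledTime i) + u / Real.sqrt n * y : ℝ) : ℂ) * Complex.I) ∂μ with hφ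
  have habs := integrable_abs_of_integrable_sq hsq
  have hE := tendsto_natCast_mul_measureReal_ne hA o hlam
  have hEm : ∀ n, MeasurableSet {y | A n y ≠ o} := fun n =>
    (hA n (measurableSet_singleton o)).compl
  have hchar := tendsto_natCast_mul_charFun_sub_one hmean hvar u
  have hsqrt := tendsto_sqrt_mul_setIntegral_abs hsq hEm hE
  have hk0 : ∀ t, k o t = 0 := fun t => by simp [hk, ho]
  have hprod : ∀ n, ∏ i, φ n i = ∏ i, (1 + (φ n i - 1)) := fun n =>
    Finset.prod_congr rfl fun i _ => (add_sub_cancel _ _).symm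
  refine Tendsto.congr (fun n => (hprod n).symm) ?_
  -- the bound on the individual factors
  obtain ⟨B, hB⟩ : ∃ B, ∀ᶠ n : ℕ in atTop, ∀ i, ‖φ n i - 1‖ ≤ B / n := by
    obtain ⟨B₁, h1⟩ : ∃ B, ∀ᶠ n : ℕ in atTop, ‖(n : ℂ) * (charFun μ (u / Real.sqrt n) - 1)‖ ≤ B :=
      ⟨_, hchar.norm.eventually_le_const (lt_add_one _)⟩
    obtain ⟨B₂, h2⟩ : ∃ B, ∀ᶠ n : ℕ in atTop, n * μ.real {y | A n y ≠ o} ≤ B :=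
      ⟨_, hE.eventually_le_const (lt_add_one _)⟩
    refine ⟨B₁ + 2 * B₂, ?_⟩
    filter_upwards [h1, h2, eventually_gt_atTop 0] with n hn1 hn2 hn i
    have hn0 : (0 : ℝ) < n := by exact_mod_cast hn
    rw [le_div_iff₀ hn0]
    rw [norm_mul, Complex.norm_natCast] at hn1
    have h3 := norm_integral_exp_sub_charFun_le (μ := μ) (hA n)
      (h := fun f => h f (scaledTime i)) (ho _) (u / Real.sqrt n)
    have h4 : ‖φ n i - 1‖ ≤ ‖charFun μ (u / Real.sqrt n) - 1‖ + 2 * μ.real {y | A n y ≠ o} := by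
      calc ‖φ n i - 1‖ = ‖(charFun μ (u / Real.sqrt n) - 1) +
            (φ n i - charFun μ (u / Real.sqrt n))‖ := by congr 1; ring
        _ ≤ _ := (norm_add_le _ _).trans (add_le_add le_rfl h3)
    calc ‖φ n i - 1‖ * n
        ≤ (‖charFun μ (u / Real.sqrt n) - 1‖ + 2 * μ.real {y | A n y ≠ o}) * n := by gcongr
      _ = n * ‖charFun μ (u / Real.sqrt n) - 1‖ + 2 * (n * μ.real {y | A n y ≠ o}) := by ring
      _ ≤ _ := add_le_add hn1 (mul_le_mul_of_nonneg_left hn2 zero_le_two)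
  refine tendsto_prod_one_add_of_tendsto_sum (fun n i => ?_) hB ?_
  · rw [add_sub_cancel]
    exact norm_integral_exp_ofReal_mul_I_le _
  -- the sum of the mark contributions
  have hmark : Tendsto (fun n : ℕ => ∑ i : Fin n, ∫ y, k (A n y) (scaledTime i) ∂μ) atTop
      (𝓝 (∑ f, (lam f : ℂ) * ∫ t, k f t ∂uniformTime)) := by
    have hterm : ∀ f, Tendsto (fun n : ℕ => ((n * μ.real {y | A n y = f} : ℝ) : ℂ) *
        ((1 / n : ℝ) • ∑ i : Fin n, k f (scaledTime i))) atTop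
        (𝓝 ((lam f : ℂ) * ∫ t, k f t ∂uniformTime)) := by
      intro f
      -- No limit is assumed for the trivial mark, but its factor `k o` is zero, so `lam o` may be
      -- anything.
      by_cases hf : f = o
      · subst hf
        simp [hk0]
      · refine ((Complex.continuous_ofReal.tendsto _).comp (hlam f hf)).mul
          (tendsto_riemannSum ?_ fun t => norm_exp_ofReal_mul_I_sub_one_le_two _)
        have := hh f
        fun_prop
    refine (tendsto_finsetSum Finset.univ fun f _ => hterm f).congr' ?_
    filter_upwards [eventually_gt_atTop 0] with n hn
    have hn0 : (n : ℂ) ≠ 0 := by exact_mod_cast hn.ne'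
    have h1 : ∀ i : Fin n, ∫ y, k (A n y) (scaledTime i) ∂μ =
        ∑ f, (μ.real {y | A n y = f} : ℂ) * k f (scaledTime i) := fun i =>
      integral_comp_of_finite (hA n) fun f => k f (scaledTime i)
    simp_rw [h1]
    rw [Finset.sum_comm]
    refine Finset.sum_congr rfl fun f _ => ?_
    rw [← Finset.mul_sum, Complex.real_smul]
    push_cast
    field_simp
  -- the sum of the remainders
  have hrem : Tendsto (fun n : ℕ => ∑ i : Fin n, (φ n i - 1 - (charFun μ (u / Real.sqrt n) - 1) -
      ∫ y, k (A n y) (scaledTime i) ∂μ)) atTop (𝓝 0) := by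
    -- There are `n` remainders, each at most `2 |u| / √n` times the first absolute moment over
    -- nontrivial marks.
    have hz : Tendsto (fun n : ℕ => 2 * |u| * (Real.sqrt n * ∫ y in {y | A n y ≠ o}, |y| ∂μ)) atTop
        (𝓝 0) := by simpa using hsqrt.const_mul (2 * |u|)
    refine squeeze_zero_norm' ?_ hz
    filter_upwards [eventually_gt_atTop 0] with n hn
    have hn0 : (0 : ℝ) < n := by exact_mod_cast hn
    refine (norm_sum_le _ _).trans ((Finset.sum_le_sum fun i _ =>
      norm_integral_exp_sub_sub_le (μ := μ) (hA n) (h := fun f => h f (scaledTime i)) (ho _) habs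
        (u / Real.sqrt n)).trans_eq ?_)
    rw [Finset.sum_const, Finset.card_univ, Fintype.card_fin, nsmul_eq_mul, abs_div,
      abs_of_nonneg (Real.sqrt_nonneg _)]
    have hs : Real.sqrt n ≠ 0 := (Real.sqrt_pos.2 hn0).ne'
    have hs2 : (n : ℝ) = Real.sqrt n * Real.sqrt n := (Real.mul_self_sqrt hn0.le).symm
    nth_rewrite 1 [hs2]
    field_simp
  have hlim := (hchar.add hmark).add hrem
  have hval : -(u : ℂ) ^ 2 / 2 + ∑ f, (lam f : ℂ) * ∫ t, k f t ∂uniformTime + 0 =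
      ∑ f, (lam f : ℂ) * ∫ t, k f t ∂uniformTime - (u : ℂ) ^ 2 / 2 := by ring
  rw [hval] at hlim
  refine hlim.congr fun n => ?_
  rw [Finset.sum_sub_distrib, Finset.sum_sub_distrib, Finset.sum_const (charFun μ _ - 1),
    Finset.card_univ, Fintype.card_fin, nsmul_eq_mul]
  ring

end CharacteristicFunctional

/-! ### The characteristic functional of the limit -/

section LimitFunctional

lemma integral_infinitePi_prod_fin {T : Type*} [MeasurableSpace T] {α : Measure T}
    [IsProbabilityMeasure α] {k : ℕ} {f : Fin k → T → ℂ} (hf : ∀ i, Measurable (f i)) :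
    ∫ q : ℕ → T, ∏ i : Fin k, f i (q i) ∂(Measure.infinitePi fun _ => α) =
      ∏ i, ∫ t, f i t ∂α := by
  have hind : iIndepFun (fun (i : ℕ) (q : ℕ → T) => q i) (Measure.infinitePi fun _ : ℕ => α) :=
    iIndepFun_infinitePi (X := fun _ t => t) fun _ => measurable_id
  have hind' := hind.precomp (g := fun i : Fin k => (i : ℕ)) Fin.val_injective
  rw [hind'.integral_fun_prod_comp (f := f) (fun i => (measurable_pi_apply _).aemeasurable)
    fun i => (hf i).aestronglyMeasurable]
  refine Finset.prod_congr rfl fun i _ => ?_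
  have hmp := measurePreserving_eval_infinitePi (fun _ : ℕ => α) i
  have h := integral_map (μ := Measure.infinitePi fun _ : ℕ => α) hmp.measurable.aemeasurable
    (hf i).aestronglyMeasurable
  rw [hmp.map_eq] at h
  exact h.symm

/-- By Fubini the thinning variables are integrated for fixed positions, then the positions;
independence across points gives a `k`-th power. -/
lemma integral_infinitePi_prod_prod_fin {T V : Type*} [MeasurableSpace T] [MeasurableSpace V]
    {α : Measure T} {β : Measure V} [IsProbabilityMeasure α] [IsProbabilityMeasure β]
    {e : T → V → ℂ} (he : Measurable (Function.uncurry e)) (hle : ∀ t v, ‖e t v‖ ≤ 1) (k : ℕ) :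
    ∫ q : (ℕ → T) × (ℕ → V), ∏ i : Fin k, e (q.1 i) (q.2 i)
      ∂((Measure.infinitePi fun _ => α).prod (Measure.infinitePi fun _ => β)) =
      (∫ t, ∫ v, e t v ∂β ∂α) ^ k := by
  have hm : Measurable fun q : (ℕ → T) × (ℕ → V) => ∏ i : Fin k, e (q.1 i) (q.2 i) :=
    Finset.measurable_prod _ fun i _ => he.comp
      (show Measurable fun q : (ℕ → T) × (ℕ → V) => (q.1 i, q.2 i) by fun_prop)
  rw [integral_prod _ (Integrable.of_bound hm.aestronglyMeasurable 1
    (Eventually.of_forall fun q => ?_))]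
  · have h1 : ∀ a : ℕ → T, ∫ b : ℕ → V, ∏ i : Fin k, e (a i) (b i)
        ∂(Measure.infinitePi fun _ => β) = ∏ i : Fin k, ∫ v, e (a i) v ∂β := fun a =>
      integral_infinitePi_prod_fin fun i => he.comp measurable_prodMk_left
    simp_rw [h1]
    rw [integral_infinitePi_prod_fin (f := fun _ t => ∫ v, e t v ∂β) fun i =>
      he.stronglyMeasurable.integral_prod_right.measurable]
    simp
  · rw [norm_prod]
    exact Finset.prod_le_one (fun i _ => norm_nonneg _) fun i _ => hle _ _

/-- The Poisson generating function at a complex argument. Averaging the `k`-th powers over the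
number of points yields the exponential in the limit functional. -/
lemma integral_pow_poissonMeasure (τ : NNReal) (w : ℂ) :
    ∫ k, w ^ k ∂(poissonMeasure τ) = Complex.exp (τ * (w - 1)) := by
  rw [integral_poissonMeasure]
  have h : ∀ k : ℕ, (Real.exp (-τ) * τ ^ k / k.factorial : ℝ) • w ^ k =
      Complex.exp (-τ) * ((τ * w) ^ k / k.factorial) := fun k => by
    rw [Complex.real_smul]
    push_cast
    rw [mul_pow]
    ring
  simp_rw [h]
  rw [tsum_mul_left, (NormedSpace.expSeries_div_hasSum_exp ((τ : ℂ) * w)).tsum_eq,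
    ← Complex.exp_eq_exp_ℂ, ← Complex.exp_add]
  congr 1
  ring

variable {r : ℕ}

/-- The joint law of the variables that decide about the thinnings of a point. -/
noncomputable abbrev thinningVariableLaw (r : ℕ) : Measure (Fin r → TimeInterval) :=
  Measure.pi fun _ => uniformTime

/-- The limiting intensity of the points present exactly at the levels in `A`. -/
noncomputable def clusterIntensity (G : ℝ → ℝ) (x : Fin (r + 1) → ℝ)
    (A : Finset (Fin (r + 1))) : ℝ :=
  exceedanceIntensity G (x (Fin.last r)) *
    (thinningVariableLaw r).real {v | survivedLevels G x v = A}

lemma integral_limitProcess (g : BoundedContinuousFunction StateSpace ℝ) (G : ℝ → ℝ)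
    (x : Fin (r + 1) → ℝ) (ζ : ThinningSpace r) :
    ∫ p, g p ∂(limitProcess G x ζ : Measure StateSpace) =
      ∑ i : Fin ζ.1, clusterSum g (survivedLevels G x (ζ.2.2 i)) (ζ.2.1 i) := by
  rw [limitProcess_eq, integral_finiteMeasure_sum]
  exact Finset.sum_congr rfl fun i _ => integral_clusterMeasure _ _ _

lemma measurable_exp_clusterSum (g : BoundedContinuousFunction StateSpace ℝ) (G : ℝ → ℝ)
    (x : Fin (r + 1) → ℝ) :
    Measurable (Function.uncurry fun (t : TimeInterval) (v : Fin r → TimeInterval) =>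
      Complex.exp ((clusterSum g (survivedLevels G x v) t : ℂ) * Complex.I)) := by
  have h := measurable_borel_of_pieces (X := ℂ)
    (L := fun q : TimeInterval × (Fin r → TimeInterval) => survivedLevels G x q.2)
    (fun A => measurable_snd (measurableSet_survivedLevels G x A))
    (η := fun q : TimeInterval × (Fin r → TimeInterval) => q.1) measurable_fst
    (F := fun A t => Complex.exp ((clusterSum g A t : ℂ) * Complex.I)) fun A => by
      have := continuous_clusterSum g A
      fun_prop
  rwa [← BorelSpace.measurable_eq (α := ℂ)] at h

/-- The mark probabilities add up to one, so the subtracted `1` can be distributed over the marks.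
This gives the exponent the form found for the exceedances. -/
lemma integral_exp_clusterSum_survivedLevels (g : BoundedContinuousFunction StateSpace ℝ)
    (G : ℝ → ℝ) (x : Fin (r + 1) → ℝ) :
    ∫ t, ∫ v, Complex.exp ((clusterSum g (survivedLevels G x v) t : ℂ) * Complex.I)
      ∂(thinningVariableLaw r) ∂uniformTime - 1 =
    ∑ A, ((thinningVariableLaw r).real {v | survivedLevels G x v = A} : ℂ) *
      ∫ t, (Complex.exp ((clusterSum g A t : ℂ) * Complex.I) - 1) ∂uniformTime := by
  let _ : MeasurableSpace (Finset (Fin (r + 1))) := ⊤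
  have hS : Measurable (survivedLevels G x) :=
    measurable_to_countable' fun A => measurableSet_survivedLevels G x A
  have hint : ∀ A : Finset (Fin (r + 1)), Integrable
      (fun t => Complex.exp ((clusterSum g A t : ℂ) * Complex.I)) uniformTime := fun A =>
    integrable_exp_ofReal_mul_I (continuous_clusterSum g A).measurable
  have h1 : ∀ t, ∫ v, Complex.exp ((clusterSum g (survivedLevels G x v) t : ℂ) * Complex.I)
      ∂(thinningVariableLaw r) = ∑ A, ((thinningVariableLaw r).real
        {v | survivedLevels G x v = A} : ℂ) *
          Complex.exp ((clusterSum g A t : ℂ) * Complex.I) := fun t =>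
    integral_comp_of_finite hS fun A => Complex.exp ((clusterSum g A t : ℂ) * Complex.I)
  have h2 : (1 : ℂ) = ∑ A, ((thinningVariableLaw r).real {v | survivedLevels G x v = A} : ℂ) := by
    have := integral_comp_of_finite (μ := thinningVariableLaw r) hS fun _ => (1 : ℂ)
    simpa using this
  simp_rw [h1]
  rw [integral_finsetSum _ fun A _ => (hint A).const_mul _]
  conv_lhs => rw [h2]
  rw [← Finset.sum_sub_distrib]
  refine Finset.sum_congr rfl fun A _ => ?_
  rw [integral_const_mul, integral_sub (hint A) (integrable_const _), mul_sub]
  simp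

/-- The joint characteristic functional of the limit process and an independent standard normal
variable. -/
theorem integral_pairCharacter_limit (g : BoundedContinuousFunction StateSpace ℝ) (u : ℝ)
    (G : ℝ → ℝ) (x : Fin (r + 1) → ℝ) (hτ : 0 ≤ exceedanceIntensity G (x (Fin.last r))) :
    ∫ p, pairCharacter g u (limitProcess G x p.1, p.2) ∂((thinningLaw G x).prod (gaussianReal 0 1)) =
      Complex.exp (∑ A, (clusterIntensity G x A : ℂ) *
        ∫ t, (Complex.exp ((clusterSum g A t : ℂ) * Complex.I) - 1) ∂uniformTime -
          (u : ℂ) ^ 2 / 2) := by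
  set e : TimeInterval → (Fin r → TimeInterval) → ℂ := fun t v =>
    Complex.exp ((clusterSum g (survivedLevels G x v) t : ℂ) * Complex.I) with he
  set χ : ThinningSpace r → ℂ := fun ζ => ∏ i : Fin ζ.1, e (ζ.2.1 i) (ζ.2.2 i) with hχ
  have hsplit : ∀ p : ThinningSpace r × ℝ, pairCharacter g u (limitProcess G x p.1, p.2) =
      χ p.1 * Complex.exp ((u : ℂ) * p.2 * Complex.I) := by
    intro p
    rw [pairCharacter_apply, integral_limitProcess, hχ]
    simp only [he]
    rw [← Complex.exp_sum, ← Complex.exp_add, ← Finset.sum_mul]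
    push_cast
    rw [add_mul]
  -- `χ` is the character with `u = 0` evaluated at the limit process, hence measurable.
  have hχm : Measurable χ := by
    have h1 : Measurable[_, borel (FiniteMeasure StateSpace × ℝ)] fun ζ : ThinningSpace r =>
        (limitProcess G x ζ, (0 : ℝ)) := by
      let _ : MeasurableSpace (FiniteMeasure StateSpace × ℝ) := borel _
      exact (measurable_limitProcess_pair G x).comp (g := fun q : ThinningSpace r × ℝ =>
        (limitProcess G x q.1, q.2)) (f := fun ζ => (ζ, (0 : ℝ)))
        (measurable_id.prodMk measurable_const)
    have h2 : Measurable[borel (FiniteMeasure StateSpace × ℝ), _] (pairCharacter g 0) := by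
      let _ : MeasurableSpace (FiniteMeasure StateSpace × ℝ) := borel _
      have _ : BorelSpace (FiniteMeasure StateSpace × ℝ) := ⟨rfl⟩
      exact (pairCharacter g 0).continuous.measurable
    have h3 : χ = fun ζ => pairCharacter g 0 (limitProcess G x ζ, (0 : ℝ)) := by
      ext ζ
      rw [pairCharacter_apply, integral_limitProcess, hχ]
      simp only [he]
      rw [← Complex.exp_sum, ← Finset.sum_mul]
      push_cast
      simp
    rw [h3]
    let _ : MeasurableSpace (FiniteMeasure StateSpace × ℝ) := borel _
    exact h2.comp h1
  have hχle : ∀ ζ, ‖χ ζ‖ ≤ 1 := fun ζ => by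
    rw [hχ, norm_prod]
    exact Finset.prod_le_one (fun i _ => norm_nonneg _)
      fun i _ => (Complex.norm_exp_ofReal_mul_I _).le
  simp_rw [hsplit]
  rw [integral_prod_mul χ fun z : ℝ => Complex.exp ((u : ℂ) * z * Complex.I), ← charFun_apply_real, charFun_gaussianReal]
  have hthin : ∫ ζ, χ ζ ∂(thinningLaw G x) = ∫ k, (∫ t, ∫ v, e t v ∂(thinningVariableLaw r)
      ∂uniformTime) ^ k ∂(poissonMeasure (exceedanceIntensity G (x (Fin.last r))).toNNReal) := by
    rw [thinningLaw, integral_prod _ (Integrable.of_bound hχm.aestronglyMeasurable 1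
      (Eventually.of_forall hχle))]
    refine integral_congr_ae (Eventually.of_forall fun k => ?_)
    exact integral_infinitePi_prod_prod_fin (measurable_exp_clusterSum g G x)
      (fun t v => (Complex.norm_exp_ofReal_mul_I _).le) k
  rw [hthin, integral_pow_poissonMeasure, integral_exp_clusterSum_survivedLevels,
    ← Complex.exp_add, Real.coe_toNNReal _ hτ, Finset.mul_sum]
  have hsum : ∀ A, (exceedanceIntensity G (x (Fin.last r)) : ℂ) *
      (((thinningVariableLaw r).real {v | survivedLevels G x v = A} : ℂ) *
        ∫ t, (Complex.exp ((clusterSum g A t : ℂ) * Complex.I) - 1) ∂uniformTime) =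
      (clusterIntensity G x A : ℂ) *
        ∫ t, (Complex.exp ((clusterSum g A t : ℂ) * Complex.I) - 1) ∂uniformTime := fun A => by
    rw [clusterIntensity, Complex.ofReal_mul, mul_assoc]
  simp_rw [hsum]
  congr 1
  simp
  ring

end LimitFunctional

/-! ### Intensities of clusters -/

section Intensities

variable {r : ℕ}

/-- The indicator of a nonempty set of levels is a linear combination of membership indicators, on
the family of upper sets. -/
lemma exists_coeff_indicator_eq (A : Finset (Fin (r + 1))) (hA : A ≠ ∅) :
    ∃ c : Fin (r + 1) → ℝ, ∀ B : Finset (Fin (r + 1)), (∀ i ∈ B, ∀ j, i ≤ j → j ∈ B) →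
      (if B = A then (1 : ℝ) else 0) = ∑ j, c j * if j ∈ B then 1 else 0 := by
  by_cases hup : ∀ i ∈ A, ∀ j, i ≤ j → j ∈ A
  swap
  · refine ⟨0, fun B hB => ?_⟩
    rw [if_neg (by rintro rfl; exact hup hB)]
    simp
  have hne := Finset.nonempty_iff_ne_empty.2 hA
  set m := A.min' hne with hm
  have hmA : m ∈ A := A.min'_mem hne
  have hmem : ∀ j, j ∈ A ↔ m ≤ j := fun j =>
    ⟨fun hj => A.min'_le j hj, fun hj => hup m hmA j hj⟩
  -- Here `A` consists of the indices from `m` on. If `m = 0`, an upper set equals `A` exactly when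
  -- it contains `0`. Otherwise it equals `A` exactly when it contains `m` but not its predecessor
  -- `l.castSucc`; containing the predecessor implies containing `m`, so the indicator is a
  -- difference.
  by_cases h0 : m = 0
  · refine ⟨fun j => if j = m then 1 else 0, fun B hB => ?_⟩
    simp only [ite_mul, one_mul, zero_mul, Finset.sum_ite_eq', Finset.mem_univ, if_true]
    refine if_congr ⟨fun h => h ▸ hmA, fun h => ?_⟩ rfl rfl
    ext j
    rw [hmem, h0]
    exact ⟨fun _ => Fin.zero_le j, fun _ => hB m h j (h0 ▸ Fin.zero_le j)⟩
  · obtain ⟨l, hl⟩ := Fin.exists_succ_eq.2 h0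
    refine ⟨fun j => (if j = m then 1 else 0) - if j = l.castSucc then 1 else 0, fun B hB => ?_⟩
    simp only [sub_mul, ite_mul, one_mul, zero_mul, Finset.sum_sub_distrib, Finset.sum_ite_eq',
      Finset.mem_univ, if_true]
    have hlm : l.castSucc < m := hl ▸ Fin.castSucc_lt_succ
    by_cases h1 : l.castSucc ∈ B
    · have h2 : m ∈ B := hB _ h1 m hlm.le
      rw [if_pos h1, if_pos h2, sub_self, if_neg]
      rintro rfl
      exact absurd ((hmem _).1 h1) (not_le.2 hlm)
    · rw [if_neg h1, sub_zero]
      refine if_congr ⟨fun h => h ▸ hmA, fun h => ?_⟩ rfl rfl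
      ext j
      rw [hmem]
      refine ⟨fun hj => ?_, fun hj => hB m h j hj⟩
      by_contra hjm
      have h3 : j ≤ l.castSucc := by
        rw [← hl, not_le, Fin.lt_def, Fin.val_succ] at hjm
        rw [Fin.le_def, Fin.val_castSucc]
        omega
      exact h1 (hB j hj _ h3)

/-- Integrates the pointwise identity for indicators. Used with the same coefficients for exceeded
and for survived levels, it reduces cluster intensities to single levels. -/
lemma measureReal_eq_sum_of_upper {α : Type*} [MeasurableSpace α] (ρ : Measure α)
    [IsProbabilityMeasure ρ] {S : α → Finset (Fin (r + 1))}
    (hS : ∀ A, MeasurableSet {y | S y = A}) (hup : ∀ y, ∀ i ∈ S y, ∀ j, i ≤ j → j ∈ S y)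
    {A : Finset (Fin (r + 1))} {c : Fin (r + 1) → ℝ}
    (hc : ∀ B : Finset (Fin (r + 1)), (∀ i ∈ B, ∀ j, i ≤ j → j ∈ B) →
      (if B = A then (1 : ℝ) else 0) = ∑ j, c j * if j ∈ B then 1 else 0) :
    ρ.real {y | S y = A} = ∑ j, c j * ρ.real {y | j ∈ S y} := by
  have hm : ∀ j, MeasurableSet {y | j ∈ S y} := fun j => by
    have h : {y | j ∈ S y} = ⋃ B ∈ {B : Finset (Fin (r + 1)) | j ∈ B}, {y | S y = B} := by
      ext y
      simp
    rw [h]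
    exact MeasurableSet.biUnion (Set.to_countable _) fun B _ => hS B
  have hind : ∀ {s : Set α}, MeasurableSet s → ∫ y, s.indicator (fun _ => (1 : ℝ)) y ∂ρ = ρ.real s :=
    fun hs => by rw [integral_indicator_const _ hs, smul_eq_mul, mul_one]
  rw [← hind (hS A)]
  have h1 : ∀ y, {y | S y = A}.indicator (fun _ => (1 : ℝ)) y =
      ∑ j, c j * {y | j ∈ S y}.indicator (fun _ => (1 : ℝ)) y := fun y => by
    simpa [Set.indicator_apply] using hc (S y) (hup y)
  simp_rw [h1]
  rw [integral_finsetSum _ fun j _ => ((integrable_const (1 : ℝ)).indicator (hm j)).const_mul _]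
  refine Finset.sum_congr rfl fun j _ => ?_
  rw [integral_const_mul, hind (hm j)]

lemma survivedLevels_upper (G : ℝ → ℝ) (x : Fin (r + 1) → ℝ) (v : Fin r → TimeInterval) :
    ∀ i ∈ survivedLevels G x v, ∀ j, i ≤ j → j ∈ survivedLevels G x v := by
  intro i hi j hij
  simp only [survivedLevels, Finset.mem_filter, Finset.mem_univ, true_and] at hi ⊢
  exact fun m hm => hi m (hij.trans hm)

lemma exceededLevels_upper {a b : ℕ → ℝ} {x : Fin (r + 1) → ℝ} (hx : Antitone x) {n : ℕ}
    (ha : 0 < a n) (y : ℝ) :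
    ∀ i ∈ exceededLevels a b x n y, ∀ j, i ≤ j → j ∈ exceededLevels a b x n y := by
  intro i hi j hij
  simp only [exceededLevels, Finset.mem_filter, Finset.mem_univ, true_and] at hi ⊢
  refine lt_of_le_of_lt ?_ hi
  have h := mul_le_mul_of_nonneg_left (hx hij) (inv_nonneg.2 ha.le)
  unfold level
  linarith

lemma thinningVariableLaw_real_survivesTo (G : ℝ → ℝ) (x : Fin (r + 1) → ℝ)
    (hρ : ∀ m, retentionProb G x m ∈ Set.Icc (0 : ℝ) 1) (j : Fin (r + 1)) :
    (thinningVariableLaw r).real {v | SurvivesTo G x v j} =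
      ∏ m : Fin r, if j ≤ m.castSucc then retentionProb G x m else 1 := by
  have h : {v : Fin r → TimeInterval | SurvivesTo G x v j} = Set.univ.pi fun m =>
      {t : TimeInterval | j ≤ m.castSucc → (t : ℝ) ≤ retentionProb G x m} := by
    ext v
    simp [SurvivesTo, Set.mem_pi]
  rw [h, measureReal_def, Measure.pi_pi, ENNReal.toReal_prod]
  refine Finset.prod_congr rfl fun m _ => ?_
  split_ifs with hm
  · simp only [hm, true_imp_iff]
    exact uniformTime_real_le (hρ m).1 (hρ m).2
  · simp [hm]

/-- The product of the retention ratios telescopes, by induction from the last level. -/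
lemma intensity_mul_survivesTo {G : ℝ → ℝ} {x : Fin (r + 1) → ℝ}
    (hnn : ∀ j, 0 ≤ exceedanceIntensity G (x j))
    (hmono : Monotone fun j => exceedanceIntensity G (x j)) (j : Fin (r + 1)) :
    exceedanceIntensity G (x (Fin.last r)) *
      (thinningVariableLaw r).real {v | SurvivesTo G x v j} = exceedanceIntensity G (x j) := by
  have hρ : ∀ m, retentionProb G x m ∈ Set.Icc (0 : ℝ) 1 := fun m =>
    ⟨div_nonneg (hnn _) (hnn _), div_le_one_of_le₀ (hmono m.castSucc_le_succ) (hnn _)⟩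
  rw [thinningVariableLaw_real_survivesTo G x hρ]
  induction j using Fin.reverseInduction with
  | last =>
    rw [Finset.prod_eq_one fun m _ => if_neg (not_le.2 m.castSucc_lt_last), mul_one]
  | cast m ih =>
    have hstep : (∏ l : Fin r, if m.castSucc ≤ l.castSucc then retentionProb G x l else 1) =
        retentionProb G x m * ∏ l : Fin r, if m.succ ≤ l.castSucc then retentionProb G x l else 1 := by
      rw [← Finset.mul_prod_erase _ _ (Finset.mem_univ m),
        ← Finset.mul_prod_erase Finset.univ
          (fun l : Fin r => if m.succ ≤ l.castSucc then retentionProb G x l else 1)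
          (Finset.mem_univ m), if_pos le_rfl, if_neg (not_le.2 Fin.castSucc_lt_succ), one_mul]
      congr 1
      -- For `l ≠ m` the conditions `m ≤ l` and `m + 1 ≤ l` coincide; only the factor at `m` is new.
      refine Finset.prod_congr rfl fun l hl => if_congr ?_ rfl rfl
      have hne : (l : ℕ) ≠ m := fun h => Finset.ne_of_mem_erase hl (Fin.ext h)
      rw [Fin.le_def, Fin.le_def, Fin.val_castSucc, Fin.val_castSucc, Fin.val_succ]
      omega
    rw [hstep, mul_left_comm, ih, retentionProb]
    -- If the denominator is zero, monotonicity forces the numerator to be zero, so the convention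
    -- for division by zero does no harm.
    refine div_mul_cancel_of_imp fun h => ?_
    exact le_antisymm (h ▸ hmono m.castSucc_le_succ) (hnn _)

/-- Convergence of the intensities of exceedances of single levels implies convergence of the
intensities of clusters. -/
theorem tendsto_natCast_mul_measureReal_exceededLevels {μ : Measure ℝ} [IsProbabilityMeasure μ]
    {a b : ℕ → ℝ} (ha : ∀ n, 1 ≤ n → 0 < a n) {G : ℝ → ℝ} {x : Fin (r + 1) → ℝ} (hx : Antitone x)
    (hτ : ∀ j, Tendsto (fun n : ℕ => n * μ.real (Set.Ioi (level a b n (x j)))) atTop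
      (𝓝 (exceedanceIntensity G (x j))))
    (hnn : ∀ j, 0 ≤ exceedanceIntensity G (x j))
    (hmono : Monotone fun j => exceedanceIntensity G (x j))
    (A : Finset (Fin (r + 1))) (hA : A ≠ ∅) :
    Tendsto (fun n : ℕ => n * μ.real {y | exceededLevels a b x n y = A}) atTop
      (𝓝 (clusterIntensity G x A)) := by
  obtain ⟨c, hc⟩ := exists_coeff_indicator_eq A hA
  have hlim : clusterIntensity G x A = ∑ j, c j * exceedanceIntensity G (x j) := by
    rw [clusterIntensity, measureReal_eq_sum_of_upper _ (measurableSet_survivedLevels G x)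
      (survivedLevels_upper G x) hc, Finset.mul_sum]
    refine Finset.sum_congr rfl fun j _ => ?_
    rw [← intensity_mul_survivesTo hnn hmono j]
    simp only [survivedLevels, Finset.mem_filter, Finset.mem_univ, true_and]
    ring
  rw [hlim]
  refine (tendsto_finsetSum Finset.univ fun j _ => (hτ j).const_mul (c j)).congr' ?_
  filter_upwards [eventually_ge_atTop 1] with n hn
  rw [measureReal_eq_sum_of_upper _ (measurableSet_exceededLevels a b x n)
    (exceededLevels_upper hx (ha n hn)) hc, Finset.mul_sum]
  refine Finset.sum_congr rfl fun j _ => ?_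
  have h : {y | j ∈ exceededLevels a b x n y} = Set.Ioi (level a b n (x j)) := by
    ext y
    simp [exceededLevels]
  rw [h]
  ring

end Intensities

/-! ### Samples -/

section Sample

lemma integral_exceedanceProcess {Ω : Type*} (X : ℕ → Ω → ℝ) {r : ℕ} (g : BoundedContinuousFunction StateSpace ℝ) (a b : ℕ → ℝ)
    (x : Fin (r + 1) → ℝ) (n : ℕ) (ω : Ω) :
    ∫ p, g p ∂(exceedanceProcess X a b x n ω : Measure StateSpace) =
      ∑ i : Fin n, clusterSum g (exceededLevels a b x n (X i ω)) (scaledTime i) := by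
  rw [exceedanceProcess_eq, integral_finiteMeasure_sum]
  exact Finset.sum_congr rfl fun i _ => integral_clusterMeasure _ _ _

variable {Ω : Type*} [MeasurableSpace Ω] {P : Measure Ω}
  {X : ℕ → Ω → ℝ} {r : ℕ}

lemma measureReal_preimage_of_identDistrib (hmeas : ∀ i, Measurable (X i))
    (hident : ∀ i, IdentDistrib (X i) (X 0) P P) (i : ℕ) {s : Set ℝ} (hs : MeasurableSet s) :
    P.real (X i ⁻¹' s) = (P.map (X 0)).real s := by
  rw [← (hident i).map_eq, map_measureReal_apply (hmeas i) hs]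

lemma measureReal_partialMax_le [IsProbabilityMeasure P] (hmeas : ∀ i, Measurable (X i)) (hindep : iIndepFun X P)
    (hident : ∀ i, IdentDistrib (X i) (X 0) P P) {n : ℕ} (hn : 1 ≤ n) (l : ℝ) :
    P.real {ω | partialMax X n ω ≤ l} = (1 - (P.map (X 0)).real (Set.Ioi l)) ^ n := by
  have hprob : IsProbabilityMeasure (P.map (X 0)) :=
    Measure.isProbabilityMeasure_map (hmeas 0).aemeasurable
  have hne : Nonempty (Fin n) := ⟨⟨0, hn⟩⟩
  have h : {ω | partialMax X n ω ≤ l} =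
      ⋂ i ∈ (Finset.univ : Finset (Fin n)), X i ⁻¹' Set.Iic l := by
    ext ω
    simp [partialMax, ciSup_le_iff (Set.finite_range fun i : Fin n => X i ω).bddAbove]
  have hind := hindep.precomp (g := fun i : Fin n => (i : ℕ)) Fin.val_injective
  rw [h, measureReal_def, hind.measure_inter_preimage_eq_mul Finset.univ
    fun i _ => measurableSet_Iic, ENNReal.toReal_prod]
  have h1 : ∀ i : Fin n, (P (X i ⁻¹' Set.Iic l)).toReal =
      1 - (P.map (X 0)).real (Set.Ioi l) := fun i => by
    rw [← measureReal_def, measureReal_preimage_of_identDistrib hmeas hident i measurableSet_Iic,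
      ← Set.compl_Ioi, probReal_compl_eq_one_sub measurableSet_Ioi]
  rw [Finset.prod_congr rfl fun i _ => h1 i]
  simp

/-- Convergence of the distribution of the maxima determines the asymptotic probabilities of
exceedances. -/
theorem tendsto_natCast_mul_measureReal_level [IsProbabilityMeasure P] (hmeas : ∀ i, Measurable (X i))
    (hindep : iIndepFun X P) (hident : ∀ i, IdentDistrib (X i) (X 0) P P) {a b : ℕ → ℝ}
    (ha : ∀ n, 1 ≤ n → 0 < a n) {G : ℝ → ℝ} {z : ℝ} (hpos : 0 < G z)
    (hmax : Tendsto (fun n : ℕ => P.real {ω | a n * (partialMax X n ω - b n) ≤ z}) atTop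
      (𝓝 (G z))) :
    Tendsto (fun n : ℕ => n * (P.map (X 0)).real (Set.Ioi (level a b n z))) atTop
      (𝓝 (exceedanceIntensity G z)) := by
  have hprob : IsProbabilityMeasure (P.map (X 0)) :=
    Measure.isProbabilityMeasure_map (hmeas 0).aemeasurable
  refine tendsto_natCast_mul_of_tendsto_one_sub_pow (fun n => measureReal_le_one) hpos
    (hmax.congr' ?_)
  filter_upwards [eventually_ge_atTop 1] with n hn
  rw [← measureReal_partialMax_le hmeas hindep hident hn]
  congr 1
  ext ω
  have han := ha n hn
  change a n * (partialMax X n ω - b n) ≤ z ↔ partialMax X n ω ≤ (a n)⁻¹ * z + b n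
  rw [← sub_le_iff_le_add, inv_mul_eq_div, le_div_iff₀ han, mul_comm]

/-- The joint characteristic functional of the exceedances and the normalized sum factorizes. -/
theorem integral_pairCharacter_exceedanceProcess (hmeas : ∀ i, Measurable (X i))
    (hindep : iIndepFun X P) (hident : ∀ i, IdentDistrib (X i) (X 0) P P)
    (g : BoundedContinuousFunction StateSpace ℝ) (u : ℝ) (a b : ℕ → ℝ) (x : Fin (r + 1) → ℝ)
    (n : ℕ) :
    ∫ ω, pairCharacter g u (exceedanceProcess X a b x n ω, partialSum X n ω / Real.sqrt n) ∂P =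
      ∏ i : Fin n, ∫ y, Complex.exp (((clusterSum g (exceededLevels a b x n y) (scaledTime i) +
        u / Real.sqrt n * y : ℝ) : ℂ) * Complex.I) ∂(P.map (X 0)) := by
  set f : Fin n → ℝ → ℂ := fun i y =>
    Complex.exp (((clusterSum g (exceededLevels a b x n y) (scaledTime i) +
      u / Real.sqrt n * y : ℝ) : ℂ) * Complex.I) with hf
  have hfm : ∀ i, Measurable (f i) := fun i => by
    have h := measurable_borel_of_pieces (X := ℝ) (L := exceededLevels a b x n)
      (measurableSet_exceededLevels a b x n) (η := fun _ : ℝ => (0 : ℝ)) measurable_const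
      (F := fun A _ => clusterSum g A (scaledTime i)) fun A => continuous_const
    rw [← BorelSpace.measurable_eq (α := ℝ)] at h
    fun_prop
  have hsplit : ∀ ω, pairCharacter g u (exceedanceProcess X a b x n ω,
      partialSum X n ω / Real.sqrt n) = ∏ i : Fin n, f i (X i ω) := fun ω => by
    rw [pairCharacter_apply, integral_exceedanceProcess, hf]
    simp only
    rw [← Complex.exp_sum, ← Finset.sum_mul, ← Complex.ofReal_sum, Finset.sum_add_distrib,
      ← Finset.mul_sum, partialSum]
    congr 4
    ring
  simp_rw [hsplit]
  have hind := hindep.precomp (g := fun i : Fin n => (i : ℕ)) Fin.val_injective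
  rw [hind.integral_fun_prod_comp (f := f) (fun i => (hmeas i).aemeasurable)
    fun i => (hfm i).aestronglyMeasurable]
  refine Finset.prod_congr rfl fun i _ => ?_
  rw [← (hident i).map_eq, integral_map (hmeas i).aemeasurable (hfm i).aestronglyMeasurable]

/-! ### Tightness -/

/-- Chebyshev's inequality; the sum has variance `n`. -/
lemma measureReal_partialSum_gt_le [IsProbabilityMeasure P] (hmeas : ∀ i, Measurable (X i)) (hindep : iIndepFun X P)
    (hident : ∀ i, IdentDistrib (X i) (X 0) P P) (hL2 : MemLp (X 0) 2 P)
    (hmean : ∫ ω, X 0 ω ∂P = 0) (hvar : ∫ ω, X 0 ω ^ 2 ∂P = 1) {n : ℕ} (hn : 1 ≤ n) {c : ℝ}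
    (hc : 0 < c) : P.real {ω | c < |partialSum X n ω / Real.sqrt n|} ≤ 1 / c ^ 2 := by
  have hn0 : (0 : ℝ) < n := by exact_mod_cast hn
  have hs : 0 < Real.sqrt n := Real.sqrt_pos.2 hn0
  have hL : ∀ i, MemLp (X i) 2 P := fun i => (hident i).memLp_iff.2 hL2
  have hSeq : (∑ i : Fin n, X i) = partialSum X n := by
    ext ω
    simp [partialSum]
  have hSL : MemLp (partialSum X n) 2 P := hSeq ▸ memLp_finsetSum' _ fun i _ => hL i
  have hVar0 : Var[X 0; P] = 1 := by
    rw [variance_eq_integral (hmeas 0).aemeasurable, hmean]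
    simpa using hvar
  have hVar : Var[partialSum X n; P] = n := by
    rw [← hSeq, IndepFun.variance_sum (X := fun i : Fin n => X i) (fun i _ => hL i)
      fun i _ j _ hij => hindep.indepFun fun h => hij (Fin.ext h)]
    simp [fun i : ℕ => (hident i).variance_eq, hVar0]
  have hMean : ∫ ω, partialSum X n ω ∂P = 0 := by
    unfold partialSum
    rw [integral_finsetSum _ fun (i : Fin n) _ => (hL i).integrable one_le_two]
    exact Finset.sum_eq_zero fun i _ => (hident i).integral_eq.trans hmean
  have h := meas_ge_le_variance_div_sq hSL (mul_pos hc hs)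
  rw [hMean, hVar] at h
  have hsub : {ω | c < |partialSum X n ω / Real.sqrt n|} ⊆
      {ω | c * Real.sqrt n ≤ |partialSum X n ω - 0|} := fun ω hω => by
    have hω' : c < |partialSum X n ω / Real.sqrt n| := hω
    rw [abs_div, abs_of_pos hs, lt_div_iff₀ hs] at hω'
    simpa using hω'.le
  refine (measureReal_mono hsub).trans ?_
  rw [measureReal_def]
  refine (ENNReal.toReal_mono ENNReal.ofReal_ne_top h).trans_eq ?_
  rw [ENNReal.toReal_ofReal (by positivity), mul_pow, Real.sq_sqrt hn0.le]
  field_simp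

/-- Markov's inequality; an integer above `N` is at least `N + 1`. -/
lemma measureReal_card_nonempty_gt_le [IsProbabilityMeasure P] (hmeas : ∀ i, Measurable (X i))
    (hident : ∀ i, IdentDistrib (X i) (X 0) P P) {F : Type*} [DecidableEq F] {A : ℝ → F} {o : F}
    (hA : MeasurableSet {y | A y ≠ o}) (n N : ℕ) :
    P.real {ω | N < (Finset.univ.filter fun i : Fin n => A (X i ω) ≠ o).card} ≤
      n * (P.map (X 0)).real {y | A y ≠ o} / (N + 1) := by
  have hcard : ∀ ω, ((Finset.univ.filter fun i : Fin n => A (X i ω) ≠ o).card : ℝ) =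
      ∑ i : Fin n, (X i ⁻¹' {y | A y ≠ o}).indicator (fun _ => (1 : ℝ)) ω := fun ω => by
    rw [Finset.card_filter]
    push_cast
    exact Finset.sum_congr rfl fun i _ => by simp [Set.indicator_apply]
  have hi : ∀ i : Fin n, Integrable ((X i ⁻¹' {y | A y ≠ o}).indicator fun _ => (1 : ℝ)) P :=
    fun i => (integrable_const _).indicator (hmeas i hA)
  have hint : ∫ ω, ((Finset.univ.filter fun i : Fin n => A (X i ω) ≠ o).card : ℝ) ∂P =
      n * (P.map (X 0)).real {y | A y ≠ o} := by
    simp_rw [hcard]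
    rw [integral_finsetSum _ fun i _ => hi i]
    have h1 : ∀ i : Fin n, ∫ ω, (X i ⁻¹' {y | A y ≠ o}).indicator (fun _ => (1 : ℝ)) ω ∂P =
        (P.map (X 0)).real {y | A y ≠ o} := fun i => by
      rw [integral_indicator_const _ (hmeas i hA), smul_eq_mul, mul_one,
        measureReal_preimage_of_identDistrib hmeas hident i hA]
    rw [Finset.sum_congr rfl fun i _ => h1 i]
    simp
  have hmark := mul_meas_ge_le_integral_of_nonneg (μ := P)
    (f := fun ω => ((Finset.univ.filter fun i : Fin n => A (X i ω) ≠ o).card : ℝ))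
    (Eventually.of_forall fun ω => Nat.cast_nonneg _)
    (by simp_rw [hcard]; exact integrable_finsetSum _ fun i _ => hi i) ((N : ℝ) + 1)
  rw [hint] at hmark
  rw [le_div_iff₀ (by positivity), mul_comm]
  refine le_trans ?_ hmark
  refine mul_le_mul_of_nonneg_left (measureReal_mono fun ω hω => ?_) (by positivity)
  exact_mod_cast Nat.succ_le_of_lt hω

/-- A union bound over the at most `δ n` indices with scaled time below `δ`. -/
lemma measureReal_exists_early_le [IsProbabilityMeasure P] (hmeas : ∀ i, Measurable (X i))
    (hident : ∀ i, IdentDistrib (X i) (X 0) P P) {F : Type*} {A : ℝ → F} {o : F}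
    (hA : MeasurableSet {y | A y ≠ o}) (n : ℕ) {δ : ℝ} (hδ : 0 ≤ δ) :
    P.real {ω | ∃ i : Fin n, A (X i ω) ≠ o ∧ (scaledTime i : ℝ) < δ} ≤
      δ * (n * (P.map (X 0)).real {y | A y ≠ o}) := by
  classical
  set s : Finset (Fin n) := Finset.univ.filter fun i => (scaledTime i : ℝ) < δ with hs
  have hcard : (s.card : ℝ) ≤ δ * n := by
    have h1 : s.card ≤ (Finset.range ⌊δ * n⌋₊).card := by
      refine Finset.card_le_card_of_injOn (fun i => (i : ℕ)) (fun i hi => ?_)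
        (Fin.val_injective.injOn)
      have hi' : (scaledTime i : ℝ) < δ := (Finset.mem_filter.1 hi).2
      have hn0 : (0 : ℝ) < n := by exact_mod_cast i.pos
      change ((i : ℕ) + 1 : ℝ) / n < δ at hi'
      rw [div_lt_iff₀ hn0] at hi'
      rw [Finset.mem_coe, Finset.mem_range]
      exact Nat.lt_of_succ_le (Nat.le_floor (by push_cast; exact hi'.le))
    rw [Finset.card_range] at h1
    exact (Nat.cast_le.2 h1).trans (Nat.floor_le (by positivity))
  have hsub : {ω | ∃ i : Fin n, A (X i ω) ≠ o ∧ (scaledTime i : ℝ) < δ} ⊆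
      ⋃ i ∈ s, X i ⁻¹' {y | A y ≠ o} := by
    rintro ω ⟨i, h1, h2⟩
    exact Set.mem_biUnion (Finset.mem_filter.2 ⟨Finset.mem_univ i, h2⟩) h1
  calc P.real {ω | ∃ i : Fin n, A (X i ω) ≠ o ∧ (scaledTime i : ℝ) < δ}
      ≤ P.real (⋃ i ∈ s, X i ⁻¹' {y | A y ≠ o}) := measureReal_mono hsub (measure_ne_top _ _)
    _ ≤ ∑ i ∈ s, P.real (X i ⁻¹' {y | A y ≠ o}) := measureReal_biUnion_finset_le _ _
    _ = s.card * (P.map (X 0)).real {y | A y ≠ o} := by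
        rw [Finset.sum_congr rfl fun (i : Fin n) _ =>
          measureReal_preimage_of_identDistrib hmeas hident i hA]
        simp
    _ ≤ δ * n * (P.map (X 0)).real {y | A y ≠ o} := by gcongr
    _ = _ := mul_assoc _ _ _

/-- A sequence of compact sets of pairs of a finite measure and a real number. -/
def tightnessSet (r N : ℕ) : Set (FiniteMeasure StateSpace × ℝ) :=
  lateClusterSums r (1 / ((N : ℝ) + 1)) N ×ˢ Set.Icc (-((N : ℝ) + 1)) ((N : ℝ) + 1)

lemma isCompact_tightnessSet (r N : ℕ) : IsCompact (tightnessSet r N) :=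
  (isCompact_lateClusterSums (by positivity) N).prod isCompact_Icc

lemma one_div_natCast_add_one_le_one (N : ℕ) : 1 / ((N : ℝ) + 1) ≤ 1 := by
  rw [div_le_one (by positivity)]
  simp

/-- The set can be left through too many nonempty clusters, an early one, or a large sum. The first
two events cost `C / (N + 1)` each, the last `1 / (N + 1)²`. -/
lemma measureReal_notMem_tightnessSet_le [IsProbabilityMeasure P] (hmeas : ∀ i, Measurable (X i)) (hindep : iIndepFun X P)
    (hident : ∀ i, IdentDistrib (X i) (X 0) P P) (hL2 : MemLp (X 0) 2 P)
    (hmean : ∫ ω, X 0 ω ∂P = 0) (hvar : ∫ ω, X 0 ω ^ 2 ∂P = 1) (a b : ℕ → ℝ)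
    (x : Fin (r + 1) → ℝ) {n : ℕ} (hn : 1 ≤ n) (N : ℕ) {C : ℝ}
    (hC : n * (P.map (X 0)).real {y | exceededLevels a b x n y ≠ ∅} ≤ C) :
    P.real {ω | (exceedanceProcess X a b x n ω, partialSum X n ω / Real.sqrt n) ∉
      tightnessSet r N} ≤ (2 * C + 1) * (1 / ((N : ℝ) + 1)) := by
  have hN : (0 : ℝ) < (N : ℝ) + 1 := by positivity
  have hA : MeasurableSet {y | exceededLevels a b x n y ≠ ∅} :=
    (measurableSet_exceededLevels a b x n ∅).compl
  have hsub : {ω | (exceedanceProcess X a b x n ω, partialSum X n ω / Real.sqrt n) ∉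
      tightnessSet r N} ⊆
      ({ω | N < (Finset.univ.filter fun i : Fin n => exceededLevels a b x n (X i ω) ≠ ∅).card} ∪
      {ω | ∃ i : Fin n, exceededLevels a b x n (X i ω) ≠ ∅ ∧
        (scaledTime i : ℝ) < 1 / ((N : ℝ) + 1)}) ∪
      {ω | (N : ℝ) + 1 < |partialSum X n ω / Real.sqrt n|} := by
    intro ω hω
    by_contra hcon
    simp only [Set.mem_union, Set.mem_ofPred_eq, not_or, not_lt, not_exists, not_and] at hcon
    obtain ⟨⟨h1, h2⟩, h3⟩ := hcon
    refine hω ⟨?_, abs_le.1 h3⟩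
    simp only [exceedanceProcess_eq]
    exact sum_clusterMeasure_mem_lateClusterSums (one_div_natCast_add_one_le_one N) _ _ _ h1
      fun i _ hi => h2 i hi
  have h1 := measureReal_card_nonempty_gt_le (o := ∅) hmeas hident hA n N
  have h2 := measureReal_exists_early_le (o := ∅) hmeas hident hA n
    (δ := 1 / ((N : ℝ) + 1)) (by positivity)
  have h3 := measureReal_partialSum_gt_le hmeas hindep hident hL2 hmean hvar hn hN
  have h4 : 1 / ((N : ℝ) + 1) ^ 2 ≤ 1 / ((N : ℝ) + 1) := by
    rw [sq, ← one_div_mul_one_div]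
    exact mul_le_of_le_one_left (by positivity) (one_div_natCast_add_one_le_one N)
  have h5 : n * (P.map (X 0)).real {y | exceededLevels a b x n y ≠ ∅} / ((N : ℝ) + 1) ≤
      C * (1 / ((N : ℝ) + 1)) := by
    rw [div_eq_mul_one_div]
    gcongr
  have h6 : 1 / ((N : ℝ) + 1) * (n * (P.map (X 0)).real {y | exceededLevels a b x n y ≠ ∅}) ≤
      1 / ((N : ℝ) + 1) * C := by gcongr
  refine (measureReal_mono hsub).trans ((measureReal_union_le _ _).trans
    ((add_le_add (measureReal_union_le _ _) le_rfl).trans ?_))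
  linarith

/-- A realization has finitely many points, all at positive times, so it lies in `tightnessSet r N`
for every large `N`; pointwise convergence of indicators then gives convergence of measures. -/
lemma tendsto_measureReal_notMem_tightnessSet (G : ℝ → ℝ) (x : Fin (r + 1) → ℝ) (ν : Measure ℝ)
    [IsProbabilityMeasure ν] :
    Tendsto (fun N : ℕ => ((thinningLaw G x).prod ν).real
      {p | (limitProcess G x p.1, p.2) ∉ tightnessSet r N}) atTop (𝓝 0) := by
  have hm : ∀ N, MeasurableSet {p : ThinningSpace r × ℝ |
      (limitProcess G x p.1, p.2) ∉ tightnessSet r N} := fun N => by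
    let _ : MeasurableSpace (FiniteMeasure StateSpace × ℝ) := borel _
    have _ : BorelSpace (FiniteMeasure StateSpace × ℝ) := ⟨rfl⟩
    exact measurable_limitProcess_pair G x (isCompact_tightnessSet r N).isClosed.measurableSet.compl
  have hev : ∀ p : ThinningSpace r × ℝ, ∀ᶠ N in atTop,
      (p ∈ {p : ThinningSpace r × ℝ | (limitProcess G x p.1, p.2) ∉ tightnessSet r N} ↔
        p ∈ (∅ : Set (ThinningSpace r × ℝ))) := by
    intro p
    have h1 : ∀ᶠ N : ℕ in atTop, ∀ i : Fin p.1.1, 1 / ((N : ℝ) + 1) ≤ (p.1.2.1 i : ℝ) :=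
      eventually_all.2 fun i =>
        (tendsto_one_div_add_atTop_nhds_zero_nat (𝕜 := ℝ)).eventually_le_const (p.1.2.1 i).2.1
    have h2 : ∀ᶠ N : ℕ in atTop, |p.2| ≤ N :=
      tendsto_natCast_atTop_atTop.eventually_ge_atTop |p.2|
    filter_upwards [h1, h2, eventually_ge_atTop p.1.1] with N hN1 hN2 hN3
    simp only [Set.mem_empty_iff_false, iff_false, not_not]
    refine ⟨?_, abs_le.1 (hN2.trans (by linarith))⟩
    simp only [limitProcess_eq]
    refine sum_clusterMeasure_mem_lateClusterSums (one_div_natCast_add_one_le_one N) _ _ _ ?_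
      fun i _ _ => hN1 i
    exact (Finset.card_filter_le _ _).trans (by simpa using hN3)
  have h := tendsto_measure_of_tendsto_indicator_of_isFiniteMeasure (μ := (thinningLaw G x).prod ν)
    atTop hm hev
  rw [measure_empty] at h
  exact (ENNReal.tendsto_toReal ENNReal.zero_ne_top).comp h

end Sample

/-! ### Marginal convergence and the main theorem -/

lemma measurable_limitProcess {r : ℕ} (G : ℝ → ℝ) (x : Fin (r + 1) → ℝ) :
    Measurable[_, borel (FiniteMeasure StateSpace)] (limitProcess G x) := by
  let _ : MeasurableSpace (FiniteMeasure StateSpace × ℝ) := borel _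
  have _ : BorelSpace (FiniteMeasure StateSpace × ℝ) := ⟨rfl⟩
  let _ : MeasurableSpace (FiniteMeasure StateSpace) := borel _
  have _ : BorelSpace (FiniteMeasure StateSpace) := ⟨rfl⟩
  have h : Measurable fun ζ : ThinningSpace r => (limitProcess G x ζ, (0 : ℝ)) :=
    (measurable_limitProcess_pair G x).comp (g := fun q : ThinningSpace r × ℝ =>
      (limitProcess G x q.1, q.2)) (f := fun ζ => (ζ, (0 : ℝ)))
      (measurable_id.prodMk measurable_const)
  exact continuous_fst.measurable.comp h

/-- Asymptotic independence includes the convergence in distribution of the first component. -/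
lemma AsymptoticallyIndependent.fst {E E' Ω Ω' Ω'' : Type*} [TopologicalSpace E]
    [TopologicalSpace E'] [MeasurableSpace Ω] [MeasurableSpace Ω'] [MeasurableSpace Ω'']
    {P : Measure Ω} [IsProbabilityMeasure P] {ξ : ℕ → Ω → E} {η : ℕ → Ω → E'}
    {Q : Measure Ω'} [IsProbabilityMeasure Q] {ζ : Ω' → E}
    {R : Measure Ω''} [IsProbabilityMeasure R] {θ : Ω'' → E'}
    (h : AsymptoticallyIndependent P ξ η Q ζ R θ) (hζ : Measurable[_, borel E] ζ) :
    ConvergesInDistribution P ξ Q ζ := by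
  let _ : MeasurableSpace (E × E') := borel _
  have _ : BorelSpace (E × E') := ⟨rfl⟩
  let _ : MeasurableSpace E := borel _
  have _ : BorelSpace E := ⟨rfl⟩
  have hfst := TendstoInDistribution.continuous_comp continuous_fst h
  change TendstoInDistribution ξ atTop ζ (fun _ => P) Q
  refine ⟨hfst.forall_aemeasurable, hζ.aemeasurable, ?_⟩
  -- The first marginal of the product law is `Q`, because `R` has mass one.
  have hmap : (Q.prod R).map (Prod.fst ∘ fun p => (ζ p.1, θ p.2)) = Q.map ζ := by
    have hcomp : (Prod.fst ∘ fun p : Ω' × Ω'' => (ζ p.1, θ p.2)) = ζ ∘ Prod.fst := rfl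
    rw [hcomp, ← Measure.map_map hζ measurable_fst, measurePreserving_fst.map_eq]
  have hlim := hfst.tendsto
  simp only [hmap] at hlim
  exact hlim

theorem theorem2p4 {Ω : Type*} [MeasurableSpace Ω] (P : Measure Ω) [IsProbabilityMeasure P]
    (X : ℕ → Ω → ℝ) (hmeas : ∀ i, Measurable (X i)) (hindep : iIndepFun X P)
    (hident : ∀ i, IdentDistrib (X i) (X 0) P P)
    (hL2 : MemLp (X 0) 2 P) (hmean : ∫ ω, X 0 ω ∂P = 0) (hvar : ∫ ω, X 0 ω ^ 2 ∂P = 1)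
    (a b : ℕ → ℝ) (ha : ∀ n, 1 ≤ n → 0 < a n)
    (G : ℝ → ℝ) (hG : IsFiniteVarianceExtremeValueCDF G)
    (hmax : ∀ z : ℝ, Tendsto (fun n : ℕ => P.real {ω | a n * (partialMax X n ω - b n) ≤ z})
      atTop (𝓝 (G z)))
    {r : ℕ} (x : Fin (r + 1) → ℝ) (hx : Antitone x) (hpos : ∀ j, 0 < G (x j)) :
    ConvergesInDistribution P (exceedanceProcess X a b x) (thinningLaw G x) (limitProcess G x) ∧
      AsymptoticallyIndependent P (exceedanceProcess X a b x)
        (fun n ω => partialSum X n ω / Real.sqrt n)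
        (thinningLaw G x) (limitProcess G x) (gaussianReal 0 1) (fun z : ℝ => z) := by
  have hprob : IsProbabilityMeasure (P.map (X 0)) :=
    Measure.isProbabilityMeasure_map (hmeas 0).aemeasurable
  have hsq : Integrable (fun y : ℝ => y ^ 2) (P.map (X 0)) :=
    (integrable_map_measure (by fun_prop) (hmeas 0).aemeasurable).2 hL2.integrable_sq
  have hmean' : ∫ y, y ∂(P.map (X 0)) = 0 := by
    rw [integral_map (hmeas 0).aemeasurable (by fun_prop), hmean]
  have hvar' : ∫ y, y ^ 2 ∂(P.map (X 0)) = 1 := by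
    rw [integral_map (hmeas 0).aemeasurable (by fun_prop), hvar]
  have hτ : ∀ j, Tendsto (fun n : ℕ => n * (P.map (X 0)).real (Set.Ioi (level a b n (x j)))) atTop
      (𝓝 (exceedanceIntensity G (x j))) := fun j =>
    tendsto_natCast_mul_measureReal_level hmeas hindep hident ha (hpos j) (hmax (x j))
  -- Nonnegativity, and below it monotonicity, are inherited in the limit from the exceedance
  -- probabilities.
  have hnn : ∀ j, 0 ≤ exceedanceIntensity G (x j) := fun j =>
    ge_of_tendsto' (hτ j) fun n => by positivity
  have hmono : Monotone fun j => exceedanceIntensity G (x j) := by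
    intro i j hij
    refine le_of_tendsto_of_tendsto (hτ i) (hτ j) ?_
    filter_upwards [eventually_ge_atTop 1] with n hn
    refine mul_le_mul_of_nonneg_left (measureReal_mono (Set.Ioi_subset_Ioi ?_))
      (Nat.cast_nonneg n)
    have h := mul_le_mul_of_nonneg_left (hx hij) (inv_nonneg.2 (ha n hn).le)
    unfold level
    linarith
  have hlam := tendsto_natCast_mul_measureReal_exceededLevels (μ := P.map (X 0)) ha hx hτ hnn hmono
  have hpair : AsymptoticallyIndependent P (exceedanceProcess X a b x)
      (fun n ω => partialSum X n ω / Real.sqrt n)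
      (thinningLaw G x) (limitProcess G x) (gaussianReal 0 1) (fun z : ℝ => z) := by
    let _ : MeasurableSpace (Finset (Fin (r + 1))) := ⊤
    have hS : ∀ n, Measurable (exceededLevels a b x n) := fun n =>
      measurable_to_countable' fun A => measurableSet_exceededLevels a b x n A
    refine convergesInDistribution_of_submonoid P
      (fun n ω => (exceedanceProcess X a b x n ω, partialSum X n ω / Real.sqrt n))
      ((thinningLaw G x).prod (gaussianReal 0 1)) (fun p => (limitProcess G x p.1, p.2)) (S := pairCharacters)
      (fun χ => star_mem_pairCharacters) (fun p q => pairCharacters_separate) ?_ (fun n => ?_)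
      (measurable_limitProcess_pair G x) ?_ fun ε hε => ?_
    · rintro _ ⟨g, u, rfl⟩
      exact ⟨1, fun q => (norm_pairCharacter g u q).le⟩
    · refine measurable_exceedanceProcess_pair hmeas a b x n ?_
      unfold partialSum
      fun_prop
    · rintro _ ⟨g, u, rfl⟩
      rw [integral_pairCharacter_limit g u G x (hnn _)]
      refine (tendsto_prod_integral_exp hsq hmean' hvar' hS hlam (fun A => continuous_clusterSum g A)
        (clusterSum_empty g) u).congr fun n => ?_
      exact (integral_pairCharacter_exceedanceProcess hmeas hindep hident g u a b x n).symm
    · obtain ⟨C, hC⟩ : ∃ C, ∀ᶠ n : ℕ in atTop,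
          n * (P.map (X 0)).real {y | exceededLevels a b x n y ≠ ∅} ≤ C :=
        ⟨_, (tendsto_natCast_mul_measureReal_ne hS ∅ hlam).eventually_le_const (lt_add_one _)⟩
      have hz : Tendsto (fun N : ℕ => (2 * C + 1) * (1 / ((N : ℝ) + 1))) atTop (𝓝 0) := by
        simpa using (tendsto_one_div_add_atTop_nhds_zero_nat (𝕜 := ℝ)).const_mul (2 * C + 1)
      -- One `N` serves both the bound valid for all large `n` and the tail of the limit pair.
      obtain ⟨N, hN1, hN2⟩ := ((hz.eventually_le_const hε).and
        ((tendsto_measureReal_notMem_tightnessSet G x (gaussianReal 0 1)).eventually_le_const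
          hε)).exists
      refine ⟨tightnessSet r N, isCompact_tightnessSet r N, hN2, ?_⟩
      filter_upwards [hC, eventually_ge_atTop 1] with n hn1 hn2
      exact (measureReal_notMem_tightnessSet_le hmeas hindep hident hL2 hmean hvar a b x hn2 N
        hn1).trans hN1
  refine ⟨hpair.fst (measurable_limitProcess G x), hpair⟩
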